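/- Let $\mu\in\mathbb{C}$ with $\operatorname{Re}\mu>-1$, let $\beta>0$, and let $p_1<p$ be real. Let $F,G$ be complex-valued functions such that $G$ is the inverse Laplace transform of $F$ on the half-line $x>p$, i.e. for every $x>p$ the integral $\int_0^\infty e^{-xt}G(t)\,dt$ converges absolutely and equals $F(x)$. Write $J_\mu$ for the Bessel function of the first kind and $K_\nu$ for the MacDonald function. Assume that the integral on the right-hand side of (1) below converges absolutely. Integrals on the left-hand sides are understood as improper integrals at infinity: $\int_a^\infty f=L$ means that $f$ is integrable on $(a,R)$ for every $R>a$ and $\int_a^R f\to L$ as $R\to\infty$. (1) If the integral on the left-hand side converges, then $$\int_p^\infty (x-p)^{\mu/2}(x-p_1)^{\mu/2}J_\mu\bigl(\beta\sqrt{(x-p)(x-p_1)}\bigr)F(x)\,dx=\frac{\beta^\mu(p-p_1)^{\mu+1/2}}{2^\mu\sqrt{\pi}}\int_0^\infty e^{-(p+p_1)t/2}\,G(t)\,(t^2+\beta^2)^{-\mu/2-1/4}K_{\mu+1/2}\Bigl(\tfrac{p-p_1}{2}\sqrt{t^2+\beta^2}\Bigr)dt .$$ (2) Put $\alpha=p-p_1$.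 If the integral on the left-hand side converges, then $$\int_0^\infty\frac{s^{\mu+1}J_\mu(\beta s)}{\sqrt{\alpha^2+4s^2}}\,F\Bigl(\frac{\sqrt{\alpha^2+4s^2}+\alpha+2p_1}{2}\Bigr)ds=\frac{\beta^\mu\alpha^{\mu+1/2}}{2^{\mu+1}\sqrt{\pi}}\int_0^\infty e^{-(p_1+\alpha/2)t}\,G(t)\,(t^2+\beta^2)^{-\mu/2-1/4}K_{\mu+1/2}\Bigl(\tfrac{\alpha}{2}\sqrt{t^2+\beta^2}\Bigr)dt .$$ Moreover (2) is equivalent to (1) by a change of variable: for every $L\in\mathbb{C}$, the left-hand integral in (1) converges to $L$ if and only if the left-hand integral in (2) converges to $L/2$. -/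

import Mathlib

/-- The Bessel function of the first kind `J_μ(z)`, of complex order `μ`, by its power series
`∑ (-1)^n (z/2)^(2n+μ) / (n! Γ(n+μ+1))` (principal branch of `(z/2)^μ`). Mathlib's `Gamma` is `0` at
its poles, so that `1 / Γ` has its usual value `0` there. -/
noncomputable def besselJ (μ z : ℂ) : ℂ :=
  (z / 2) ^ μ *
    ∑' n : ℕ, (-1 : ℂ) ^ n / ((n.factorial : ℂ) * Complex.Gamma ((n : ℂ) + μ + 1)) *
      (z / 2) ^ (2 * n)

/-- The modified Bessel function of the second kind (MacDonald function) `K_ν(z)`, of complex order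
`ν`, for `Re z > 0`, by `K_ν(z) = ∫_0^∞ exp(-z cosh u) cosh(ν u) du`. -/
noncomputable def besselK (ν z : ℂ) : ℂ :=
  ∫ u in Set.Ioi (0 : ℝ), Complex.exp (-z * Complex.cosh u) * Complex.cosh (ν * u)

/-- `G` is an inverse Laplace transform of `F` on the half-line `x > p`: for every `x > p` the
integral `∫_0^∞ exp(-x t) G(t) dt` converges absolutely, with value `F x`. -/
def IsInverseLaplace (G F : ℝ → ℂ) (p : ℝ) : Prop :=
  ∀ x : ℝ, p < x →
    MeasureTheory.IntegrableOn (fun t : ℝ => (Real.exp (-(x * t)) : ℂ) * G t) (Set.Ioi 0) ∧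
    F x = ∫ t in Set.Ioi (0 : ℝ), (Real.exp (-(x * t)) : ℂ) * G t

/-- `∫_a^∞ f = L` as an integral that is improper at infinity: `f` is integrable on every `(a, R)`,
and `∫_a^R f → L` as `R → ∞`. -/
def HasImproperIntegral (f : ℝ → ℂ) (a : ℝ) (L : ℂ) : Prop :=
  (∀ R : ℝ, a < R → IntervalIntegrable f MeasureTheory.volume a R) ∧
    Filter.Tendsto (fun R : ℝ => ∫ x in a..R, f x) Filter.atTop (nhds L)

/-- The integrand `(x-p)^(μ/2) (x-p₁)^(μ/2) J_μ(β √((x-p)(x-p₁))) F(x)`. -/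
noncomputable def twoPointIntegrand (μ : ℂ) (β p p₁ : ℝ) (F : ℝ → ℂ) (x : ℝ) : ℂ :=
  ((x - p : ℝ) : ℂ) ^ (μ / 2) * ((x - p₁ : ℝ) : ℂ) ^ (μ / 2) *
    besselJ μ ((β * Real.sqrt ((x - p) * (x - p₁)) : ℝ) : ℂ) * F x

/-- The integrand `s^(μ+1) J_μ(β s) F((√(α²+4s²) + α + 2p₁)/2) / √(α²+4s²)`. -/
noncomputable def shiftedIntegrand (μ : ℂ) (β α p₁ : ℝ) (F : ℝ → ℂ) (s : ℝ) : ℂ :=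
  (s : ℂ) ^ (μ + 1) * besselJ μ ((β * s : ℝ) : ℂ) / (Real.sqrt (α ^ 2 + 4 * s ^ 2) : ℂ) *
    F ((Real.sqrt (α ^ 2 + 4 * s ^ 2) + α + 2 * p₁) / 2)

/-- The integrand `exp(-q t) G(t) (t²+β²)^(-μ/2-1/4) K_{μ+1/2}(α √(t²+β²) / 2)`. -/
noncomputable def macdonaldIntegrand (μ : ℂ) (β q α : ℝ) (G : ℝ → ℂ) (t : ℝ) : ℂ :=
  (Real.exp (-(q * t)) : ℂ) * G t * ((t ^ 2 + β ^ 2 : ℝ) : ℂ) ^ (-μ / 2 - 1 / 4) *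
    besselK (μ + 1 / 2) ((α * Real.sqrt (t ^ 2 + β ^ 2) / 2 : ℝ) : ℂ)

namespace TwoPoint
open MeasureTheory Set Filter Topology

/-! ### The MacDonald function on the positive half-line -/

/-! Put `a = (p - p₁)/2` and `q = (p + p₁)/2`. The substitution `x = q + √(a² + z²)`, for which `(x
- p)(x - p₁) = z²`, turns the first integral into twice the second, so only the second has to be
evaluated. Inserting the Laplace integral for `F` reduces it, formally, to integrating `z^(μ+1)
J_μ(βz)` against `exp(-t√(a²+z²))/√(a²+z²)`. That factor is a superposition of Gaussians
`exp(-z²/(4r))` with weight `r^(-3/2) exp(-t²r - a²/(4r))` (`integral_macWeight_neg_half`). Weber's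
integral evaluates the Bessel kernel against each Gaussian, and its value turns the weight into the
one whose integral is `K_{μ+1/2}(a√(t²+β²))` up to a power (`macWeight_mul_weberValue`).

The left side need not converge absolutely, so the kernel is first damped by `exp(-εz²)`, which only
shifts the parameter in Weber's integral. `HasImproperIntegral.tendsto_gaussian` is the Abelian
theorem that recovers the improper integral as `ε → 0`. This is why convergence is assumed: the
argument identifies the value and does not prove that the limit exists.

The limit under the `t`-integral needs a majorant free of `ε`. `exists_norm_dampedTransform_le`
gives two bounds. One is `exp(-at)`, used for bounded `t` with the absolute convergence of the
Laplace integral. The other is the integral of the absolute weight, used for large `t`, where it is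
comparable to the modulus of the MacDonald factor (`exists_integral_norm_macWeight_le`).
`exists_majorant` joins the two regimes. -/

theorem one_add_sq_div_two_le_cosh (v : ℝ) : 1 + v ^ 2 / 2 ≤ Real.cosh v := by
  have h : Real.cosh v = 1 + 2 * Real.sinh (v / 2) ^ 2 := by
    have := Real.cosh_two_mul (v / 2)
    rw [Real.cosh_sq] at this
    rw [show v = 2 * (v / 2) by ring, this]
    ring_nf
  have h2 : (v / 2) ^ 2 ≤ Real.sinh (v / 2) ^ 2 := by
    rw [sq_le_sq]
    rcases le_total 0 (v / 2) with h0 | h0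
    · rw [abs_of_nonneg h0, abs_of_nonneg (Real.sinh_nonneg_iff.2 h0)]
      exact Real.self_le_sinh_iff.2 h0
    · rw [abs_of_nonpos h0, abs_of_nonpos (Real.sinh_nonpos_iff.2 h0), neg_le_neg_iff]
      exact Real.sinh_le_self_iff.2 h0
  rw [h]; nlinarith

theorem integrable_exp_quadratic {b : ℝ} (hb : 0 < b) (c : ℝ) :
    Integrable (fun x : ℝ => Real.exp (c * x - b * x ^ 2)) := by
  have := (integrable_cexp_quadratic (b := (b : ℂ)) (by simpa using hb) c 0).norm
  refine this.congr (Eventually.of_forall fun x => ?_)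
  simp only [Complex.norm_exp]
  congr 1
  rw [show (-(b : ℂ) * x ^ 2 + c * x + 0) = ((c * x - b * x ^ 2 : ℝ) : ℂ) by push_cast; ring,
    Complex.ofReal_re]

theorem integrable_exp_mul_exp_neg_cosh (ν : ℂ) {z : ℝ} (hz : 0 < z) :
    Integrable (fun v : ℝ => Complex.exp (ν * v) * (Real.exp (-(z * Real.cosh v)) : ℂ)) := by
  refine (integrable_exp_quadratic (half_pos hz) ν.re).mono' (by fun_prop)
    (Eventually.of_forall fun v => ?_)
  rw [norm_mul, Complex.norm_exp, Complex.norm_real, Real.norm_of_nonneg (Real.exp_pos _).le,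
    ← Real.exp_add]
  apply Real.exp_le_exp.2
  have := one_add_sq_div_two_le_cosh v
  have h2 : (ν * v).re = ν.re * v := by simp
  rw [h2]
  nlinarith

/-- Folding the line at 0 leaves only the even part of `exp(νv)`, which is `cosh(νv)`. -/
theorem integral_exp_mul_exp_neg_cosh (ν : ℂ) {z : ℝ} (hz : 0 < z) :
    ∫ v : ℝ, Complex.exp (ν * v) * (Real.exp (-(z * Real.cosh v)) : ℂ) = 2 * besselK ν z := by
  have hi := integrable_exp_mul_exp_neg_cosh ν hz
  rw [← intervalIntegral.integral_Iic_add_Ioi (b := 0) hi.integrableOn hi.integrableOn]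
  have h1 := integral_comp_neg_Iic 0
    (fun v : ℝ => Complex.exp (-ν * v) * (Real.exp (-(z * Real.cosh v)) : ℂ))
  simp only [neg_zero, Real.cosh_neg, Complex.ofReal_neg, neg_mul_neg] at h1
  rw [h1, ← integral_add (integrable_exp_mul_exp_neg_cosh (-ν) hz).integrableOn hi.integrableOn,
    besselK, ← integral_const_mul]
  congr 1
  ext v
  rw [show Complex.cosh (ν * v) = (Complex.exp (ν * v) + Complex.exp (-(ν * v))) / 2 from rfl]
  push_cast
  rw [show -(z : ℂ) * Complex.cosh v = -(z * Complex.cosh v) by ring]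
  ring_nf

/-- The weight `r^(ν-1) exp(-s² r - a²/(4r))`, whose integral over `r > 0` is a MacDonald
function. -/
noncomputable def macWeight (ν : ℂ) (s a r : ℝ) : ℂ :=
  (r : ℂ) ^ (ν - 1) * (Real.exp (-(s ^ 2 * r + a ^ 2 / (4 * r))) : ℂ)

/-- The scale `a/(2s)` balances the two terms of the exponent, so that they add up to `a s cosh v`;
the Jacobian `r` raises `r^(ν-1)` to `r^ν`. -/
theorem macWeight_comp_exp (ν : ℂ) {s a : ℝ} (hs : 0 < s) (ha : 0 < a) (v : ℝ) :
    |a / (2 * s) * Real.exp v| • macWeight ν s a (a / (2 * s) * Real.exp v) =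
      ((a / (2 * s) : ℝ) : ℂ) ^ ν *
        (Complex.exp (ν * v) * (Real.exp (-(a * s * Real.cosh v)) : ℂ)) := by
  have hc : 0 < a / (2 * s) := by positivity
  have hr : 0 < a / (2 * s) * Real.exp v := by positivity
  set r := a / (2 * s) * Real.exp v with hrdef
  have h1 : s ^ 2 * r + a ^ 2 / (4 * r) = a * s * Real.cosh v := by
    rw [hrdef, Real.cosh_eq, Real.exp_neg]
    have := Real.exp_pos v
    field_simp
    ring
  have h2 : (r : ℂ) ^ ν = ((a / (2 * s) : ℝ) : ℂ) ^ ν * Complex.exp (ν * v) := by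
    rw [hrdef, Complex.ofReal_mul,
      Complex.mul_cpow_ofReal_nonneg hc.le (Real.exp_pos v).le]
    congr 1
    rw [Complex.cpow_def_of_ne_zero (by exact_mod_cast (Real.exp_pos v).ne'),
      ← Complex.ofReal_log (Real.exp_pos v).le, Real.log_exp, mul_comm]
  rw [macWeight, h1, abs_of_pos hr, Complex.real_smul, ← mul_assoc, ← mul_assoc, ← h2]
  congr 1
  have hr' : (r : ℂ) ≠ 0 := by exact_mod_cast hr.ne'
  rw [Complex.cpow_sub _ _ hr', Complex.cpow_one]
  field_simp

theorem image_mul_exp {c : ℝ} (hc : 0 < c) : (fun v : ℝ => c * Real.exp v) '' univ = Ioi 0 := by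
  ext x
  simp only [image_univ, mem_range, mem_Ioi]
  constructor
  · rintro ⟨y, rfl⟩; positivity
  · intro hx
    exact ⟨Real.log (x / c), by rw [Real.exp_log (by positivity)]; field_simp⟩

theorem integrableOn_macWeight (ν : ℂ) {s a : ℝ} (hs : 0 < s) (ha : 0 < a) :
    IntegrableOn (macWeight ν s a) (Ioi 0) := by
  have hc : 0 < a / (2 * s) := by positivity
  rw [← image_mul_exp hc, integrableOn_image_iff_integrableOn_abs_deriv_smul MeasurableSet.univ
    (f' := fun v => a / (2 * s) * Real.exp v)
    (fun v _ => ((Real.hasDerivAt_exp v).const_mul _).hasDerivWithinAt)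
    (fun x _ y _ h => Real.exp_injective (mul_left_cancel₀ hc.ne' h))]
  simp only [macWeight_comp_exp ν hs ha, integrableOn_univ]
  exact (integrable_exp_mul_exp_neg_cosh ν (mul_pos ha hs)).const_mul _

theorem integral_macWeight (ν : ℂ) {s a : ℝ} (hs : 0 < s) (ha : 0 < a) :
    ∫ r in Ioi (0 : ℝ), macWeight ν s a r =
      2 * ((a / (2 * s) : ℝ) : ℂ) ^ ν * besselK ν ((a * s : ℝ) : ℂ) := by
  have hc : 0 < a / (2 * s) := by positivity
  rw [← image_mul_exp hc, integral_image_eq_integral_abs_deriv_smul MeasurableSet.univ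
    (f' := fun v => a / (2 * s) * Real.exp v)
    (fun v _ => ((Real.hasDerivAt_exp v).const_mul _).hasDerivWithinAt)
    (fun x _ y _ h => Real.exp_injective (mul_left_cancel₀ hc.ne' h))]
  simp only [macWeight_comp_exp ν hs ha, setIntegral_univ]
  rw [integral_const_mul, integral_exp_mul_exp_neg_cosh ν (mul_pos ha hs)]
  ring

theorem besselK_neg (ν z : ℂ) : besselK (-ν) z = besselK ν z := by
  simp only [besselK, neg_mul, Complex.cosh_neg]

/-- With `w = sinh(u/2)` one has `cosh u = 1 + 2w²` and `cosh(u/2) du = 2 dw`, so the integral is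
Gaussian. -/
theorem besselK_half {z : ℝ} (hz : 0 < z) :
    besselK (1 / 2) z = ((Real.sqrt (Real.pi / (2 * z)) * Real.exp (-z) : ℝ) : ℂ) := by
  have key : ∫ u in Ioi (0 : ℝ), Real.exp (-z * Real.cosh u) * Real.cosh (u / 2) =
      Real.sqrt (Real.pi / (2 * z)) * Real.exp (-z) := by
    have himg : (fun u : ℝ => Real.sinh (u / 2)) '' Ioi 0 = Ioi 0 := by
      ext x
      simp only [mem_image, mem_Ioi]
      constructor
      · rintro ⟨y, hy, rfl⟩
        exact Real.sinh_pos_iff.2 (by positivity)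
      · intro hx
        refine ⟨2 * Real.arsinh x, by simpa using hx, ?_⟩
        rw [mul_div_cancel_left₀ _ two_ne_zero, Real.sinh_arsinh]
    have h := integral_image_eq_integral_abs_deriv_smul (s := Ioi (0 : ℝ))
      (f := fun u : ℝ => Real.sinh (u / 2)) (f' := fun u => Real.cosh (u / 2) * (1 / 2))
      measurableSet_Ioi
      (fun u _ => (((hasDerivAt_id u).div_const 2).sinh).hasDerivWithinAt)
      (fun x _ y _ h => by
        have := Real.sinh_injective h
        linarith)
      (fun w => 2 * Real.exp (-z) * Real.exp (-(2 * z) * w ^ 2))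
    rw [himg, integral_const_mul, integral_gaussian_Ioi] at h
    calc _ = ∫ u in Ioi (0 : ℝ), |Real.cosh (u / 2) * (1 / 2)| •
          (2 * Real.exp (-z) * Real.exp (-(2 * z) * Real.sinh (u / 2) ^ 2)) := by
          congr 1
          ext u
          have hc := Real.cosh_pos (u / 2)
          have h2 : Real.cosh u = 1 + 2 * Real.sinh (u / 2) ^ 2 := by
            have := Real.cosh_two_mul (u / 2)
            rw [Real.cosh_sq] at this
            rw [show u = 2 * (u / 2) by ring, this]
            ring_nf
          rw [abs_of_pos (by positivity), h2, smul_eq_mul,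
            show -z * (1 + 2 * Real.sinh (u / 2) ^ 2) =
              -z + -(2 * z) * Real.sinh (u / 2) ^ 2 by ring, Real.exp_add]
          ring
      _ = _ := by rw [← h]; ring
  rw [← key, besselK, ← integral_complex_ofReal]
  congr 1
  ext u
  push_cast
  congr 2
  ring

/-- Subordination of `exp(-t y) / y` to the Gaussian. -/
theorem integral_macWeight_neg_half {t y : ℝ} (ht : 0 < t) (hy : 0 < y) :
    ∫ r in Ioi (0 : ℝ), macWeight (-(1 / 2)) t y r =
      ((2 * Real.sqrt Real.pi * (Real.exp (-(t * y)) / y) : ℝ) : ℂ) := by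
  rw [integral_macWeight _ ht hy, besselK_neg, besselK_half (mul_pos hy ht)]
  have hp := Real.pi_pos
  have h1 : (((y / (2 * t) : ℝ) : ℂ)) ^ (-(1 / 2) : ℂ) =
      ((Real.sqrt (2 * t / y) : ℝ) : ℂ) := by
    rw [show (-(1 / 2) : ℂ) = ((-(1 / 2) : ℝ) : ℂ) by push_cast; ring,
      ← Complex.ofReal_cpow (by positivity), Real.rpow_neg (by positivity), ← Real.sqrt_eq_rpow,
      ← Real.sqrt_inv, inv_div]
  rw [h1]
  norm_cast
  have h2 : Real.sqrt (2 * t / y) * Real.sqrt (Real.pi / (2 * (y * t))) = Real.sqrt Real.pi / y := by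
    rw [← Real.sqrt_mul (by positivity), show 2 * t / y * (Real.pi / (2 * (y * t))) =
      Real.pi / y ^ 2 by field_simp, Real.sqrt_div hp.le, Real.sqrt_sq hy.le]
  calc _ = 2 * (Real.sqrt (2 * t / y) * Real.sqrt (Real.pi / (2 * (y * t)))) *
        Real.exp (-(y * t)) := by ring
    _ = _ := by rw [h2, mul_comm y t]; ring

theorem norm_cosh_le (z : ℂ) : ‖Complex.cosh z‖ ≤ Real.exp |z.re| := by
  rw [Complex.cosh, norm_div]
  have h1 : ‖Complex.exp z + Complex.exp (-z)‖ ≤ Real.exp |z.re| + Real.exp |z.re| := by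
    refine (norm_add_le _ _).trans (add_le_add ?_ ?_) <;> rw [Complex.norm_exp] <;>
      apply Real.exp_le_exp.2
    · exact le_abs_self _
    · simpa using neg_le_abs z.re
  have : ‖(2 : ℂ)‖ = 2 := by simp
  rw [this]
  linarith

/-- Laplace's method: after rescaling `u = w/√z` the integrand tends to `exp(-w²/2)`. The limit does
not depend on `ν`, which later allows orders `ν` and `Re ν` to be compared. -/
theorem tendsto_besselK_asymptotic (ν : ℂ) :
    Tendsto (fun z : ℝ => (Real.sqrt z * Real.exp z : ℂ) * besselK ν z) atTop
      (𝓝 (Real.sqrt (Real.pi / 2) : ℂ)) := by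
  have hlim : (Real.sqrt (Real.pi / 2) : ℂ) =
      ∫ w in Ioi (0 : ℝ), (Real.exp (-(1 / 2) * w ^ 2) : ℂ) := by
    rw [integral_complex_ofReal, integral_gaussian_Ioi]
    norm_cast
    rw [show Real.pi / (1 / 2) = Real.pi / 2 * 2 ^ 2 by ring, Real.sqrt_mul (by positivity),
      Real.sqrt_sq (by norm_num)]
    ring
  have hrew : ∀ z : ℝ, 0 < z → (Real.sqrt z * Real.exp z : ℂ) * besselK ν z =
      ∫ w in Ioi (0 : ℝ), (Real.exp (-(z * (Real.cosh (w / Real.sqrt z) - 1))) : ℂ) *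
        Complex.cosh (ν * ((w / Real.sqrt z : ℝ) : ℂ)) := by
    intro z hz
    have hs := Real.sqrt_pos.2 hz
    have h := integral_comp_mul_left_Ioi
      (fun u : ℝ => (Real.exp (-(z * (Real.cosh u - 1))) : ℂ) * Complex.cosh (ν * (u : ℂ))) 0
      (inv_pos.2 hs)
    simp only [mul_zero, inv_inv] at h
    simp only [div_eq_inv_mul]
    rw [h, besselK, Complex.real_smul, mul_assoc, ← integral_const_mul]
    congr 2
    ext u
    push_cast
    rw [← mul_assoc, ← Complex.exp_add]
    congr 2
    ring
  rw [hlim]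
  refine (tendsto_integral_filter_of_dominated_convergence
    (F := fun z w => (Real.exp (-(z * (Real.cosh (w / Real.sqrt z) - 1))) : ℂ) *
      Complex.cosh (ν * ((w / Real.sqrt z : ℝ) : ℂ)))
    (fun w : ℝ => Real.exp (|ν.re| * w - (1 / 2) * w ^ 2)) ?_ ?_ ?_ ?_).congr' ?_
  · exact Eventually.of_forall fun z => by
      apply Measurable.aestronglyMeasurable
      fun_prop
  · filter_upwards [eventually_ge_atTop 1] with z hz
    filter_upwards [ae_restrict_mem measurableSet_Ioi] with w (hw : 0 < w)
    have hs : 1 ≤ Real.sqrt z := Real.one_le_sqrt.2 hz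
    have hz0 : 0 < z := by linarith
    rw [norm_mul, Complex.norm_real, Real.norm_of_nonneg (Real.exp_pos _).le,
      show |ν.re| * w - 1 / 2 * w ^ 2 = -(1 / 2 * w ^ 2) + |ν.re| * w by ring, Real.exp_add]
    refine mul_le_mul (Real.exp_le_exp.2 ?_) ((norm_cosh_le _).trans (Real.exp_le_exp.2 ?_))
      (norm_nonneg _) (Real.exp_pos _).le
    · have := one_add_sq_div_two_le_cosh (w / Real.sqrt z)
      rw [div_pow, Real.sq_sqrt hz0.le] at this
      have h2 : z * (w ^ 2 / z / 2) ≤ z * (Real.cosh (w / Real.sqrt z) - 1) := by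
        gcongr; linarith
      have h3 : z * (w ^ 2 / z / 2) = 1 / 2 * w ^ 2 := by field_simp
      linarith
    · have : (ν * ((w / Real.sqrt z : ℝ) : ℂ)).re = ν.re * (w / Real.sqrt z) := by simp
      rw [this, abs_mul]
      gcongr
      rw [abs_of_nonneg (by positivity)]
      exact div_le_self hw.le hs
  · exact (integrable_exp_quadratic (by norm_num) _).integrableOn
  · filter_upwards [ae_restrict_mem measurableSet_Ioi] with w (hw : 0 < w)
    have hx : Tendsto (fun z : ℝ => w / Real.sqrt z) atTop (𝓝 0) :=
      tendsto_const_nhds.div_atTop Real.tendsto_sqrt_atTop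
    have hc : Tendsto (fun z : ℝ => z * (Real.cosh (w / Real.sqrt z) - 1)) atTop
        (𝓝 (1 / 2 * w ^ 2)) := by
      -- Since `cosh y - 1 = 2 sinh²(y/2)`, the exponent is `w²/2` times the square of `sinh x / x`
      -- at `x = w/(2√z)`.
      have hd : Tendsto (fun z : ℝ => Real.sinh (w / (2 * Real.sqrt z)) /
          (w / (2 * Real.sqrt z))) atTop (𝓝 1) := by
        have h0 := (Real.hasDerivAt_sinh 0).tendsto_slope
        rw [Real.cosh_zero] at h0
        have hx2 : Tendsto (fun z : ℝ => w / (2 * Real.sqrt z)) atTop (𝓝[≠] 0) := by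
          rw [tendsto_nhdsWithin_iff]
          refine ⟨tendsto_const_nhds.div_atTop
            (Real.tendsto_sqrt_atTop.const_mul_atTop two_pos), ?_⟩
          filter_upwards [eventually_gt_atTop 0] with z hz
          have := Real.sqrt_pos.2 hz
          exact (by positivity : w / (2 * Real.sqrt z) ≠ 0)
        refine (h0.comp hx2).congr fun z => ?_
        simp [slope_def_field]
      have := (hd.pow 2).mul_const (1 / 2 * w ^ 2)
      rw [one_pow, one_mul] at this
      refine this.congr' ?_
      filter_upwards [eventually_gt_atTop 0] with z hz
      have hs := Real.sqrt_pos.2 hz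
      have h2 : Real.cosh (w / Real.sqrt z) = 1 + 2 * Real.sinh (w / (2 * Real.sqrt z)) ^ 2 := by
        have := Real.cosh_two_mul (w / (2 * Real.sqrt z))
        rw [Real.cosh_sq] at this
        rw [show w / Real.sqrt z = 2 * (w / (2 * Real.sqrt z)) by field_simp, this]
        ring
      rw [h2, div_pow, div_pow, mul_pow, Real.sq_sqrt hz.le]
      field_simp
      ring
    have h1 : Tendsto (fun z : ℝ => (Real.exp (-(z * (Real.cosh (w / Real.sqrt z) - 1))) : ℂ))
        atTop (𝓝 (Real.exp (-(1 / 2) * w ^ 2) : ℂ)) := by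
      have := (Complex.continuous_ofReal.tendsto _).comp
        ((Real.continuous_exp.tendsto _).comp hc.neg)
      rw [show -(1 / 2 * w ^ 2) = -(1 / 2) * w ^ 2 by ring] at this
      exact this
    have h2 : Tendsto (fun z : ℝ => Complex.cosh (ν * ((w / Real.sqrt z : ℝ) : ℂ))) atTop
        (𝓝 1) := by
      have : Continuous fun x : ℝ => Complex.cosh (ν * (x : ℂ)) := by fun_prop
      have := (this.tendsto 0).comp hx
      simpa [Function.comp_def] using this
    simpa using h1.mul h2
  · filter_upwards [eventually_gt_atTop 0] with z hz
    exact (hrew z hz).symm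

/-! ### The Bessel function of the first kind: growth and Weber's integral -/

theorem hasSum_real_exp (x : ℝ) :
    HasSum (fun n : ℕ => x ^ n / (n.factorial : ℝ)) (Real.exp x) := by
  rw [Real.exp_eq_exp_ℝ]; exact NormedSpace.expSeries_div_hasSum_exp x

theorem hasSum_complex_exp (x : ℂ) :
    HasSum (fun n : ℕ => x ^ n / (n.factorial : ℂ)) (Complex.exp x) := by
  rw [Complex.exp_eq_exp_ℂ]; exact NormedSpace.expSeries_div_hasSum_exp x

theorem Gamma_shift_ne_zero {μ : ℂ} (hμ : -1 < μ.re) (n : ℕ) :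
    Complex.Gamma ((n : ℂ) + μ + 1) ≠ 0 := by
  apply Complex.Gamma_ne_zero_of_re_pos
  simp only [Complex.add_re, Complex.natCast_re, Complex.one_re]
  have : (0 : ℝ) ≤ n := Nat.cast_nonneg n
  linarith

/-- By the functional equation, consecutive terms of `1/(Γ(n+μ+1) δⁿ)` have ratio tending to 0, so
the sequence is summable and hence bounded by its sum. -/
theorem exists_inv_Gamma_le {μ : ℂ} (hμ : -1 < μ.re) {δ : ℝ} (hδ : 0 < δ) :
    ∃ C : ℝ, 0 ≤ C ∧ ∀ n : ℕ, ‖Complex.Gamma ((n : ℂ) + μ + 1)‖⁻¹ ≤ C * δ ^ n := by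
  set f : ℕ → ℝ := fun n => (‖Complex.Gamma ((n : ℂ) + μ + 1)‖ * δ ^ n)⁻¹ with hf
  have hΓ := fun n => norm_pos_iff.2 (Gamma_shift_ne_zero hμ n)
  have hpos : ∀ n, 0 < f n := fun n => inv_pos.2 (mul_pos (hΓ n) (pow_pos hδ n))
  have hratio : ∀ n : ℕ, ‖f (n + 1)‖ / ‖f n‖ = (‖(n : ℂ) + μ + 1‖ * δ)⁻¹ := by
    intro n
    have hne : (n : ℂ) + μ + 1 ≠ 0 := by
      intro h
      have h2 := congrArg Complex.re h
      simp only [Complex.add_re, Complex.natCast_re, Complex.one_re, Complex.zero_re] at h2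
      have : (0 : ℝ) ≤ n := Nat.cast_nonneg n
      linarith
    have hn := norm_pos_iff.2 hne
    rw [Real.norm_of_nonneg (hpos _).le, Real.norm_of_nonneg (hpos _).le, hf]
    simp only
    rw [show ((n + 1 : ℕ) : ℂ) + μ + 1 = ((n : ℂ) + μ + 1) + 1 by push_cast; ring,
      Complex.Gamma_add_one _ hne, norm_mul, pow_succ]
    have := hΓ n
    have := pow_pos hδ n
    field_simp
  have hlim : Tendsto (fun n => ‖f (n + 1)‖ / ‖f n‖) atTop (𝓝 0) := by
    simp only [hratio]
    apply Tendsto.inv_tendsto_atTop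
    apply Tendsto.atTop_mul_const hδ
    refine tendsto_atTop_mono' _ ?_ (tendsto_atTop_add_const_right _ (-1 : ℝ)
      (tendsto_natCast_atTop_atTop (R := ℝ)))
    filter_upwards with n
    refine le_trans ?_ (Complex.re_le_norm _)
    simp only [Complex.add_re, Complex.natCast_re, Complex.one_re]
    linarith
  have hs : Summable f := summable_of_ratio_test_tendsto_lt_one zero_lt_one
    (Eventually.of_forall fun n => (hpos n).ne') hlim
  refine ⟨∑' n, f n, tsum_nonneg fun n => (hpos n).le, fun n => ?_⟩
  have h1 : f n ≤ ∑' n, f n := hs.le_tsum n fun m _ => (hpos m).le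
  have hp := pow_pos hδ n
  calc ‖Complex.Gamma ((n : ℂ) + μ + 1)‖⁻¹ = f n * δ ^ n := by
        simp only [hf]; have := hΓ n; field_simp
    _ ≤ _ := by gcongr

/-- The terms of the series that defines `besselJ`. -/
noncomputable def besselTerm (μ z : ℂ) (n : ℕ) : ℂ :=
  (-1 : ℂ) ^ n / ((n.factorial : ℂ) * Complex.Gamma ((n : ℂ) + μ + 1)) * (z / 2) ^ (2 * n)

theorem besselJ_eq (μ z : ℂ) : besselJ μ z = (z / 2) ^ μ * ∑' n, besselTerm μ z n := rfl

theorem exists_besselTerm_le {μ : ℂ} (hμ : -1 < μ.re) {β ε : ℝ} (hβ : 0 < β) (hε : 0 < ε) :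
    ∃ C : ℝ, 0 ≤ C ∧ ∀ (z : ℝ) (n : ℕ),
      ‖besselTerm μ ((β * z : ℝ) : ℂ) n‖ ≤ C * ((ε * z ^ 2) ^ n / (n.factorial : ℝ)) := by
  -- This `δ` makes `δ (βz/2)² = εz²`, so the bounds are the terms of the series of `exp(εz²)`.
  obtain ⟨C, hC, h⟩ := exists_inv_Gamma_le hμ (δ := 4 * ε / β ^ 2) (by positivity)
  refine ⟨C, hC, fun z n => ?_⟩
  have e1 : ‖((β * z : ℝ) : ℂ) / 2‖ ^ (2 * n) = (β ^ 2 * z ^ 2 / 4) ^ n := by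
    rw [norm_div, Complex.norm_real, pow_mul, div_pow, Real.norm_eq_abs, sq_abs]
    norm_num
    ring
  rw [besselTerm, norm_mul, norm_div, norm_mul, norm_pow, norm_pow, norm_neg, norm_one, one_pow, e1,
    Complex.norm_natCast]
  calc 1 / ((n.factorial : ℝ) * ‖Complex.Gamma ((n : ℂ) + μ + 1)‖) * (β ^ 2 * z ^ 2 / 4) ^ n
      = ‖Complex.Gamma ((n : ℂ) + μ + 1)‖⁻¹ * (β ^ 2 * z ^ 2 / 4) ^ n / (n.factorial : ℝ) := by
        rw [one_div, mul_inv]; ring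
    _ ≤ (C * (4 * ε / β ^ 2) ^ n) * (β ^ 2 * z ^ 2 / 4) ^ n / (n.factorial : ℝ) := by
        gcongr; exact h n
    _ = _ := by
        rw [mul_assoc, ← mul_pow]
        have : 4 * ε / β ^ 2 * (β ^ 2 * z ^ 2 / 4) = ε * z ^ 2 := by field_simp
        rw [this]; ring

theorem summable_besselTerm {μ : ℂ} (hμ : -1 < μ.re) {β : ℝ} (hβ : 0 < β) (z : ℝ) :
    Summable (besselTerm μ ((β * z : ℝ) : ℂ)) := by
  obtain ⟨C, -, h⟩ := exists_besselTerm_le hμ hβ one_pos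
  exact Summable.of_norm_bounded (((hasSum_real_exp _).summable).mul_left C) (h z)

/-- The kernel `z^(μ+1) J_μ(β z)` of the Hankel transform. -/
noncomputable def hankelKernel (μ : ℂ) (β z : ℝ) : ℂ :=
  (z : ℂ) ^ (μ + 1) * besselJ μ ((β * z : ℝ) : ℂ)

theorem hankelKernel_eq {μ : ℂ} {β z : ℝ} (hβ : 0 < β) (hz : 0 < z) :
    hankelKernel μ β z = ((β / 2 : ℝ) : ℂ) ^ μ * (z : ℂ) ^ (2 * μ + 1) *
      ∑' n, besselTerm μ ((β * z : ℝ) : ℂ) n := by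
  have hz' : (z : ℂ) ≠ 0 := by exact_mod_cast hz.ne'
  have h1 : (((β * z : ℝ) : ℂ) / 2) ^ μ = ((β / 2 : ℝ) : ℂ) ^ μ * (z : ℂ) ^ μ := by
    rw [← Complex.mul_cpow_ofReal_nonneg (by positivity) hz.le]
    congr 1; push_cast; ring
  rw [hankelKernel, besselJ_eq, h1, show 2 * μ + 1 = (μ + 1) + μ by ring,
    Complex.cpow_add (μ + 1) _ hz']
  ring

/-- A crude growth bound, but since `ε` is arbitrary any Gaussian damping absorbs it, and the
oscillatory asymptotics of `J_μ` are never needed. The exponent `2 Re μ + 1` exceeds `-1`, so the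
origin is harmless. -/
theorem exists_hankelKernel_le {μ : ℂ} (hμ : -1 < μ.re) {β ε : ℝ} (hβ : 0 < β) (hε : 0 < ε) :
    ∃ C : ℝ, 0 ≤ C ∧ ∀ z : ℝ, 0 < z →
      ‖hankelKernel μ β z‖ ≤ C * (z ^ (2 * μ.re + 1) * Real.exp (ε * z ^ 2)) := by
  obtain ⟨C, hC, h⟩ := exists_besselTerm_le hμ hβ hε
  refine ⟨‖((β / 2 : ℝ) : ℂ) ^ μ‖ * C, by positivity, fun z hz => ?_⟩
  rw [hankelKernel_eq hβ hz, norm_mul, norm_mul, Complex.norm_cpow_eq_rpow_re_of_pos hz]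
  have h1 := tsum_of_norm_bounded ((hasSum_real_exp (ε * z ^ 2)).mul_left C) (h z)
  have h2 : (2 * μ + 1).re = 2 * μ.re + 1 := by simp
  rw [h2]
  calc _ ≤ ‖((β / 2 : ℝ) : ℂ) ^ μ‖ * z ^ (2 * μ.re + 1) * (C * Real.exp (ε * z ^ 2)) := by gcongr
    _ = _ := by ring

theorem aestronglyMeasurable_hankelKernel {μ : ℂ} (hμ : -1 < μ.re) {β : ℝ} (hβ : 0 < β) :
    AEStronglyMeasurable (hankelKernel μ β) (volume.restrict (Ioi 0)) := by
  have h : Measurable fun z : ℝ => ∑' n, besselTerm μ ((β * z : ℝ) : ℂ) n := by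
    refine measurable_of_tendsto_metrizable (f := fun N z =>
      ∑ n ∈ Finset.range N, besselTerm μ ((β * z : ℝ) : ℂ) n) (fun N => ?_) ?_
    · unfold besselTerm; fun_prop
    · rw [tendsto_pi_nhds]
      exact fun z => (summable_besselTerm hμ hβ z).hasSum.tendsto_sum_nat
  refine AEStronglyMeasurable.congr (f := fun z : ℝ => ((β / 2 : ℝ) : ℂ) ^ μ *
    (z : ℂ) ^ (2 * μ + 1) * ∑' n, besselTerm μ ((β * z : ℝ) : ℂ) n) ?_ ?_
  · exact Measurable.aestronglyMeasurable (by fun_prop)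
  · filter_upwards [ae_restrict_mem measurableSet_Ioi] with z hz
    exact (hankelKernel_eq hβ hz).symm

theorem integrableOn_hankelKernel_mul_gaussian {μ : ℂ} (hμ : -1 < μ.re) {β c : ℝ} (hβ : 0 < β)
    (hc : 0 < c) :
    IntegrableOn (fun z => hankelKernel μ β z * (Real.exp (-(c * z ^ 2)) : ℂ)) (Ioi 0) := by
  obtain ⟨C, hC, h⟩ := exists_hankelKernel_le hμ hβ (half_pos hc)
  refine Integrable.mono' ((integrableOn_rpow_mul_exp_neg_mul_sq (half_pos hc)
    (s := 2 * μ.re + 1) (by linarith)).const_mul C)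
    ((aestronglyMeasurable_hankelKernel hμ hβ).mul
      (Measurable.aestronglyMeasurable (by fun_prop))) ?_
  filter_upwards [ae_restrict_mem measurableSet_Ioi] with z hz
  rw [norm_mul, Complex.norm_real, Real.norm_of_nonneg (Real.exp_pos _).le]
  calc _ ≤ C * (z ^ (2 * μ.re + 1) * Real.exp (c / 2 * z ^ 2)) * Real.exp (-(c * z ^ 2)) := by
        gcongr; exact h z hz
    _ = _ := by
        rw [mul_assoc, mul_assoc, ← Real.exp_add]; ring_nf

theorem integral_cpow_mul_gaussian {w : ℂ} (hw : 0 < w.re) {c : ℝ} (hc : 0 < c) :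
    ∫ z in Ioi (0 : ℝ), (z : ℂ) ^ (2 * w - 1) * (Real.exp (-(c * z ^ 2)) : ℂ) =
      1 / 2 * (1 / c : ℂ) ^ w * Complex.Gamma w := by
  have h := integral_comp_rpow_Ioi
    (fun t : ℝ => (t : ℂ) ^ (w - 1) * Complex.exp (-(c * t))) (two_ne_zero (α := ℝ))
  rw [Complex.integral_cpow_mul_exp_neg_mul_Ioi hw hc] at h
  rw [mul_assoc, ← h, ← integral_const_mul]
  refine setIntegral_congr_fun measurableSet_Ioi fun z (hz : 0 < z) => ?_
  have hz' : (z : ℂ) ≠ 0 := by exact_mod_cast hz.ne'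
  have e1 : ((z ^ (2 : ℝ) : ℝ) : ℂ) ^ (w - 1) = (z : ℂ) ^ (2 * (w - 1)) := by
    rw [← Complex.cpow_mul_ofReal_nonneg hz.le, Complex.ofReal_ofNat]
  rw [e1, Complex.real_smul, show (2 : ℝ) - 1 = 1 by norm_num, Real.rpow_one,
    show 2 * w - 1 = 2 * (w - 1) + 1 by ring, Complex.cpow_add _ _ hz', Complex.cpow_one]
  norm_num
  ring

/-- Weber's first exponential integral. -/
theorem integral_hankelKernel_mul_gaussian {μ : ℂ} (hμ : -1 < μ.re) {β c : ℝ} (hβ : 0 < β)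
    (hc : 0 < c) :
    ∫ z in Ioi (0 : ℝ), hankelKernel μ β z * (Real.exp (-(c * z ^ 2)) : ℂ) =
      1 / 2 * ((β / 2 : ℝ) : ℂ) ^ μ * (1 / c : ℂ) ^ (μ + 1) *
        (Real.exp (-(β ^ 2 / (4 * c))) : ℂ) := by
  -- With `c/2` the term bounds sum to `exp(cz²/2)`, and half of the Gaussian survives to give
  -- integrability.
  obtain ⟨C, hC, hb⟩ := exists_besselTerm_le hμ hβ (half_pos hc)
  set B : ℂ := ((β / 2 : ℝ) : ℂ) ^ μ with hB
  have hre : (2 * μ + 1).re = 2 * μ.re + 1 := by simp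
  have hc' : (c : ℂ) ≠ 0 := by exact_mod_cast hc.ne'
  have hsum := hasSum_integral_of_dominated_convergence (μ := volume.restrict (Ioi (0 : ℝ)))
    (F := fun n z => B * (z : ℂ) ^ (2 * μ + 1) * besselTerm μ ((β * z : ℝ) : ℂ) n *
      (Real.exp (-(c * z ^ 2)) : ℂ))
    (f := fun z => hankelKernel μ β z * (Real.exp (-(c * z ^ 2)) : ℂ))
    (fun n z => ‖B‖ * z ^ (2 * μ.re + 1) * Real.exp (-(c * z ^ 2)) * C *
      ((c / 2 * z ^ 2) ^ n / (n.factorial : ℝ)))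
    (fun n => by
      apply Measurable.aestronglyMeasurable
      unfold besselTerm
      fun_prop)
    (fun n => by
      filter_upwards [ae_restrict_mem measurableSet_Ioi] with z hz
      rw [norm_mul, norm_mul, norm_mul, Complex.norm_cpow_eq_rpow_re_of_pos hz, hre,
        Complex.norm_real, Real.norm_of_nonneg (Real.exp_pos _).le]
      have := Real.rpow_nonneg (mem_Ioi.1 hz).le (2 * μ.re + 1)
      calc _ ≤ ‖B‖ * z ^ (2 * μ.re + 1) * (C * ((c / 2 * z ^ 2) ^ n / (n.factorial : ℝ))) *
            Real.exp (-(c * z ^ 2)) := by gcongr; exact hb z n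
        _ = _ := by ring)
    (Eventually.of_forall fun z => (hasSum_real_exp _).summable.mul_left _)
    (by
      simp only [tsum_mul_left, (hasSum_real_exp _).tsum_eq]
      refine ((integrableOn_rpow_mul_exp_neg_mul_sq (half_pos hc)
        (s := 2 * μ.re + 1) (by linarith)).const_mul (‖B‖ * C)).congr
        (Eventually.of_forall fun z => ?_)
      simp only
      rw [show -(c / 2) * z ^ 2 = -(c * z ^ 2) + c / 2 * z ^ 2 by ring, Real.exp_add]
      ring)
    (by
      filter_upwards [ae_restrict_mem measurableSet_Ioi] with z hz
      rw [hankelKernel_eq hβ hz]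
      exact ((summable_besselTerm hμ hβ z).hasSum.mul_left _).mul_right _)
  refine hsum.unique ?_
  have hexp := (hasSum_complex_exp (-(β ^ 2 / (4 * c)) : ℂ)).mul_left
    (1 / 2 * B * (1 / c : ℂ) ^ (μ + 1))
  push_cast
  refine hexp.congr_fun fun n => ?_
  have hre2 : 0 < ((n : ℂ) + μ + 1).re := by
    simp only [Complex.add_re, Complex.natCast_re, Complex.one_re]
    have : (0 : ℝ) ≤ n := Nat.cast_nonneg n
    linarith
  have hG := Gamma_shift_ne_zero hμ n
  have hI := integral_cpow_mul_gaussian hre2 hc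
  have hcong : ∫ z in Ioi (0 : ℝ), B * (z : ℂ) ^ (2 * μ + 1) *
      besselTerm μ ((β * z : ℝ) : ℂ) n * (Real.exp (-(c * z ^ 2)) : ℂ) =
      ∫ z in Ioi (0 : ℝ), (B * ((-1 : ℂ) ^ n /
        ((n.factorial : ℂ) * Complex.Gamma ((n : ℂ) + μ + 1)) * ((β : ℂ) / 2) ^ (2 * n))) *
        ((z : ℂ) ^ (2 * ((n : ℂ) + μ + 1) - 1) * (Real.exp (-(c * z ^ 2)) : ℂ)) := by
    refine setIntegral_congr_fun measurableSet_Ioi fun z (hz : 0 < z) => ?_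
    have hz' : (z : ℂ) ≠ 0 := by exact_mod_cast hz.ne'
    simp only [besselTerm]
    rw [show 2 * ((n : ℂ) + μ + 1) - 1 = (2 * μ + 1) + ((2 * n : ℕ) : ℂ) by push_cast; ring,
      Complex.cpow_add (2 * μ + 1) _ hz', Complex.cpow_natCast]
    push_cast
    rw [show (β : ℂ) * z / 2 = β / 2 * z by ring, mul_pow]
    ring
  have hpow : (1 / c : ℂ) ^ ((n : ℂ) + μ + 1) = (1 / c : ℂ) ^ (μ + 1) * (1 / c : ℂ) ^ n := by
    rw [show (n : ℂ) + μ + 1 = (μ + 1) + (n : ℂ) by ring,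
      Complex.cpow_add _ _ (one_div_ne_zero hc'), Complex.cpow_natCast]
  push_cast at hcong hI
  -- The Gaussian moment produces `Γ(n+μ+1)`, which cancels the Bessel coefficient's denominator and
  -- leaves the exponential series.
  rw [hcong, integral_const_mul, hI, hpow,
    show (-((β : ℂ) ^ 2 / (4 * c))) = (-1) * ((β : ℂ) / 2) ^ 2 * (1 / c) by field_simp; ring,
    mul_pow, mul_pow, ← pow_mul]
  field_simp

/-! ### Subordination -/

theorem norm_macWeight (ν : ℂ) (s a : ℝ) {r : ℝ} (hr : 0 < r) :
    ‖macWeight ν s a r‖ = r ^ (ν.re - 1) * Real.exp (-(s ^ 2 * r + a ^ 2 / (4 * r))) := by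
  rw [macWeight, norm_mul, Complex.norm_cpow_eq_rpow_re_of_pos hr, Complex.norm_real,
    Real.norm_of_nonneg (Real.exp_pos _).le, Complex.sub_re, Complex.one_re]

theorem ofReal_integral_norm_macWeight (ν : ℂ) (s a : ℝ) :
    ((∫ r in Ioi (0 : ℝ), ‖macWeight ν s a r‖ : ℝ) : ℂ) =
      ∫ r in Ioi (0 : ℝ), macWeight (ν.re : ℂ) s a r := by
  rw [← integral_complex_ofReal]
  refine setIntegral_congr_fun measurableSet_Ioi fun r (hr : 0 < r) => ?_
  rw [norm_macWeight ν s a hr, macWeight, Complex.ofReal_mul, Complex.ofReal_cpow hr.le]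
  push_cast
  rfl

/-- The modulus of the weight is the weight of order `Re ν`. Taking norms of the evaluated integral
avoids having to prove that `K` of real order is positive. -/
theorem integral_norm_macWeight (ν : ℂ) {s a : ℝ} (hs : 0 < s) (ha : 0 < a) :
    ∫ r in Ioi (0 : ℝ), ‖macWeight ν s a r‖ =
      2 * (a / (2 * s)) ^ ν.re * ‖besselK (ν.re : ℂ) ((a * s : ℝ) : ℂ)‖ := by
  have h0 : 0 ≤ ∫ r in Ioi (0 : ℝ), ‖macWeight ν s a r‖ :=
    integral_nonneg fun r => norm_nonneg _
  have h := congrArg norm (ofReal_integral_norm_macWeight ν s a)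
  rw [Complex.norm_real, Real.norm_of_nonneg h0, integral_macWeight _ hs ha, norm_mul, norm_mul,
    Complex.norm_cpow_eq_rpow_re_of_pos (by positivity)] at h
  simpa using h

theorem integral_norm_macWeight_neg_half {t a : ℝ} (ht : 0 < t) (ha : 0 < a) :
    ∫ r in Ioi (0 : ℝ), ‖macWeight (-(1 / 2)) t a r‖ =
      2 * Real.sqrt Real.pi * (Real.exp (-(t * a)) / a) := by
  have h := ofReal_integral_norm_macWeight (-(1 / 2)) t a
  have h1 : (((-(1 / 2) : ℂ).re : ℝ) : ℂ) = -(1 / 2) := by norm_num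
  rw [h1, integral_macWeight_neg_half ht ha] at h
  exact_mod_cast h

theorem macWeight_add_sq {t a z : ℝ} (r : ℝ) :
    macWeight (-(1 / 2)) t (Real.sqrt (a ^ 2 + z ^ 2)) r =
      macWeight (-(1 / 2)) t a r * (Real.exp (-(z ^ 2 / (4 * r))) : ℂ) := by
  rw [macWeight, macWeight, Real.sq_sqrt (by positivity), mul_assoc, ← Complex.ofReal_mul,
    ← Real.exp_add]
  congr 3
  ring

/-- The factor `exp(-t √(a²+z²)) / √(a²+z²)`. -/
noncomputable def yukawa (a t z : ℝ) : ℝ :=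
  Real.exp (-(t * Real.sqrt (a ^ 2 + z ^ 2))) / Real.sqrt (a ^ 2 + z ^ 2)

theorem yukawa_nonneg (a t z : ℝ) : 0 ≤ yukawa a t z := by unfold yukawa; positivity

theorem yukawa_le {a t : ℝ} (ha : 0 < a) (ht : 0 < t) (z : ℝ) : yukawa a t z ≤ 1 / a := by
  unfold yukawa
  have hsa : a ≤ Real.sqrt (a ^ 2 + z ^ 2) := Real.le_sqrt_of_sq_le (by nlinarith [sq_nonneg z])
  have : Real.exp (-(t * Real.sqrt (a ^ 2 + z ^ 2))) ≤ 1 := by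
    rw [Real.exp_le_one_iff]; exact neg_nonpos.2 (by positivity)
  gcongr

theorem measurable_yukawa (a : ℝ) : Measurable fun x : ℝ × ℝ => yukawa a x.1 x.2 := by
  unfold yukawa; fun_prop

/-- Subordination followed by Fubini; the Gaussian is at most 1, so the product of the integrable
`h` and the integrable weight dominates. Bounds on the Gaussian transforms of `h` thereby become
bounds on this transform. -/
theorem integral_mul_yukawa {h : ℝ → ℂ} (hh : IntegrableOn h (Ioi 0)) {a t : ℝ} (ha : 0 < a)
    (ht : 0 < t) :
    ∫ z in Ioi (0 : ℝ), h z * (yukawa a t z : ℂ) =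
      1 / (2 * Real.sqrt Real.pi : ℂ) * ∫ r in Ioi (0 : ℝ), macWeight (-(1 / 2)) t a r *
        ∫ z in Ioi (0 : ℝ), h z * (Real.exp (-(z ^ 2 / (4 * r))) : ℂ) := by
  have hpi : (Real.sqrt Real.pi : ℂ) ≠ 0 := by
    exact_mod_cast (Real.sqrt_pos.2 Real.pi_pos).ne'
  have hprod : Integrable (Function.uncurry fun z r : ℝ => h z * (macWeight (-(1 / 2)) t a r *
      (Real.exp (-(z ^ 2 / (4 * r))) : ℂ)))
      ((volume.restrict (Ioi (0 : ℝ))).prod (volume.restrict (Ioi (0 : ℝ)))) := by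
    have hw := integrableOn_macWeight (-(1 / 2)) ht ha
    have hm : Measurable fun x : ℝ × ℝ => (Real.exp (-(x.1 ^ 2 / (4 * x.2))) : ℂ) := by fun_prop
    refine ((Integrable.mul_prod hh hw).mul_bdd (c := 1) hm.aestronglyMeasurable ?_).congr
      (Eventually.of_forall fun x => ?_)
    · rw [Measure.prod_restrict]
      filter_upwards [ae_restrict_mem (measurableSet_Ioi.prod measurableSet_Ioi)] with x hx
      have hx2 : 0 < x.2 := hx.2
      rw [Complex.norm_real, Real.norm_of_nonneg (Real.exp_pos _).le, Real.exp_le_one_iff]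
      exact neg_nonpos.2 (by positivity)
    · simp only [Function.uncurry]; ring
  have hswap := integral_integral_swap hprod
  simp only [integral_const_mul] at hswap
  have hl : ∀ z ∈ Ioi (0 : ℝ), h z * ∫ r in Ioi (0 : ℝ), macWeight (-(1 / 2)) t a r *
      (Real.exp (-(z ^ 2 / (4 * r))) : ℂ) =
      (2 * Real.sqrt Real.pi : ℂ) * (h z * (yukawa a t z : ℂ)) := by
    intro z hz
    simp only [← macWeight_add_sq]
    rw [integral_macWeight_neg_half ht (by positivity), yukawa]
    push_cast
    ring
  rw [setIntegral_congr_fun measurableSet_Ioi hl, integral_const_mul] at hswap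
  have hr : ∀ r : ℝ, ∫ z in Ioi (0 : ℝ), h z * (macWeight (-(1 / 2)) t a r *
      (Real.exp (-(z ^ 2 / (4 * r))) : ℂ)) = macWeight (-(1 / 2)) t a r *
        ∫ z in Ioi (0 : ℝ), h z * (Real.exp (-(z ^ 2 / (4 * r))) : ℂ) := by
    intro r
    rw [← integral_const_mul]
    congr 1; ext z; ring
  simp only [hr] at hswap
  rw [← hswap]
  field_simp

theorem norm_integral_mul_yukawa_le_exp {h : ℝ → ℂ} (hh : IntegrableOn h (Ioi 0)) {a t M : ℝ}
    (ha : 0 < a) (ht : 0 < t)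
    (hM : ∀ r : ℝ, 0 < r → ‖∫ z in Ioi (0 : ℝ), h z * (Real.exp (-(z ^ 2 / (4 * r))) : ℂ)‖ ≤ M) :
    ‖∫ z in Ioi (0 : ℝ), h z * (yukawa a t z : ℂ)‖ ≤ M / a * Real.exp (-(a * t)) := by
  have hs := Real.sqrt_pos.2 Real.pi_pos
  rw [integral_mul_yukawa hh ha ht, norm_mul]
  have h1 : ‖1 / (2 * Real.sqrt Real.pi : ℂ)‖ = 1 / (2 * Real.sqrt Real.pi) := by
    rw [norm_div, norm_mul, Complex.norm_real, Real.norm_of_nonneg hs.le]; simp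
  have h2 : ‖∫ r in Ioi (0 : ℝ), macWeight (-(1 / 2)) t a r *
      ∫ z in Ioi (0 : ℝ), h z * (Real.exp (-(z ^ 2 / (4 * r))) : ℂ)‖ ≤
      ∫ r in Ioi (0 : ℝ), ‖macWeight (-(1 / 2)) t a r‖ * M := by
    refine norm_integral_le_of_norm_le ((integrableOn_macWeight _ ht ha).norm.mul_const M) ?_
    filter_upwards [ae_restrict_mem measurableSet_Ioi] with r hr
    rw [norm_mul]
    gcongr
    exact hM r hr
  rw [integral_mul_const, integral_norm_macWeight_neg_half ht ha] at h2
  rw [h1]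
  calc _ ≤ 1 / (2 * Real.sqrt Real.pi) *
        (2 * Real.sqrt Real.pi * (Real.exp (-(t * a)) / a) * M) := by gcongr
    _ = _ := by rw [mul_comm t a]; field_simp

/-- A factor `r^κ` raises the order of the weight from `-1/2` to `κ - 1/2`. Only the real part of
`ν` matters, as the weight enters through its modulus; the constant `1/(2√π)` is discarded as at
most 1. -/
theorem norm_integral_mul_yukawa_le_macWeight {h : ℝ → ℂ} (hh : IntegrableOn h (Ioi 0))
    {a t A κ : ℝ} (ha : 0 < a) (ht : 0 < t)
    (hA : ∀ r : ℝ, 0 < r →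
      ‖∫ z in Ioi (0 : ℝ), h z * (Real.exp (-(z ^ 2 / (4 * r))) : ℂ)‖ ≤ A * r ^ κ) (ν : ℂ)
    (hν : ν.re = κ - 1 / 2) :
    ‖∫ z in Ioi (0 : ℝ), h z * (yukawa a t z : ℂ)‖ ≤
      A * ∫ r in Ioi (0 : ℝ), ‖macWeight ν t a r‖ := by
  have hs := Real.sqrt_pos.2 Real.pi_pos
  have hA0 : 0 ≤ A := by
    have := (norm_nonneg _).trans (hA 1 one_pos)
    simpa using this
  rw [integral_mul_yukawa hh ha ht, norm_mul]
  have h1 : ‖1 / (2 * Real.sqrt Real.pi : ℂ)‖ = 1 / (2 * Real.sqrt Real.pi) := by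
    rw [norm_div, norm_mul, Complex.norm_real, Real.norm_of_nonneg hs.le]; simp
  have h2 : ‖∫ r in Ioi (0 : ℝ), macWeight (-(1 / 2)) t a r *
      ∫ z in Ioi (0 : ℝ), h z * (Real.exp (-(z ^ 2 / (4 * r))) : ℂ)‖ ≤
      ∫ r in Ioi (0 : ℝ), A * ‖macWeight ν t a r‖ := by
    refine norm_integral_le_of_norm_le ((integrableOn_macWeight _ ht ha).norm.const_mul A) ?_
    filter_upwards [ae_restrict_mem measurableSet_Ioi] with r (hr : 0 < r)
    rw [norm_mul]
    calc _ ≤ ‖macWeight (-(1 / 2)) t a r‖ * (A * r ^ κ) := by gcongr; exact hA r hr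
      _ = _ := by
        rw [norm_macWeight _ _ _ hr, norm_macWeight _ _ _ hr, hν]
        have : r ^ (κ - 1 / 2 - 1) = r ^ ((-(1 / 2) : ℂ).re - 1) * r ^ κ := by
          rw [← Real.rpow_add hr]; congr 1; norm_num; ring
        rw [this]; ring
  rw [integral_const_mul] at h2
  have h3 : 1 / (2 * Real.sqrt Real.pi) ≤ 1 := by
    rw [div_le_one (by positivity)]
    have : 1 ≤ Real.sqrt Real.pi := Real.one_le_sqrt.2 (by linarith [Real.pi_gt_three])
    linarith
  rw [h1]
  calc _ ≤ 1 * (A * ∫ r in Ioi (0 : ℝ), ‖macWeight ν t a r‖) := by gcongr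
    _ = _ := one_mul _

theorem eventually_besselK_bounds (ν : ℂ) :
    ∀ᶠ z : ℝ in atTop, 1 ≤ Real.sqrt z * Real.exp z * ‖besselK ν z‖ ∧
      Real.sqrt z * Real.exp z * ‖besselK ν z‖ ≤ 2 := by
  have h := (tendsto_besselK_asymptotic ν).norm
  rw [Complex.norm_real, Real.norm_of_nonneg (Real.sqrt_nonneg _)] at h
  have h1 : 1 < Real.sqrt (Real.pi / 2) := by
    rw [Real.lt_sqrt zero_le_one]; linarith [Real.pi_gt_three]
  have h2 : Real.sqrt (Real.pi / 2) < 2 := by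
    rw [Real.sqrt_lt' two_pos]; linarith [Real.pi_lt_four]
  filter_upwards [h.eventually (lt_mem_nhds h1), h.eventually (gt_mem_nhds h2)] with z hz1 hz2
  rw [norm_mul, norm_mul, Complex.norm_real, Complex.norm_real,
    Real.norm_of_nonneg (Real.sqrt_nonneg _), Real.norm_of_nonneg (Real.exp_pos _).le] at hz1 hz2
  exact ⟨hz1.le, hz2.le⟩

/-- Both sides evaluate to MacDonald functions: order `Re ν` at `at` on the left, order `ν` at `aτ`
on the right, with `τ = √(t²+β²)`. Their leading asymptotics agree up to bounded factors: `τ ≤ t +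
β` costs `exp(aβ)` and `τ ≤ (1+β)t` costs a power of `1+β`. The restriction to large `t` matters
because `K_ν` of complex order can vanish. -/
theorem exists_integral_norm_macWeight_le (ν : ℂ) (hν : 0 ≤ ν.re + 1 / 2) {a β : ℝ} (ha : 0 < a)
    (hβ : 0 < β) :
    ∃ T C : ℝ, 0 < T ∧ 0 ≤ C ∧ ∀ t, T ≤ t → ∫ r in Ioi (0 : ℝ), ‖macWeight ν t a r‖ ≤
      C * ‖∫ r in Ioi (0 : ℝ), macWeight ν (Real.sqrt (t ^ 2 + β ^ 2)) a r‖ := by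
  obtain ⟨Z, hZ⟩ := eventually_atTop.1
    ((eventually_besselK_bounds ν).and (eventually_besselK_bounds (ν.re : ℂ)))
  -- The bound `t ≥ 1` gives `τ ≤ (1+β)t`, and `t ≥ Z/a` puts both arguments in the asymptotic
  -- range. The leading 2 is the quotient of the upper and lower bounds there.
  refine ⟨max 1 (Z / a), 2 * ((1 + β) ^ (ν.re + 1 / 2) * Real.exp (a * β)), by positivity,
    by positivity, fun t ht => ?_⟩
  have ht1 : 1 ≤ t := (le_max_left _ _).trans ht
  have ht0 : 0 < t := by linarith
  have htZ : Z ≤ a * t := by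
    have := (le_max_right _ _).trans ht
    rwa [div_le_iff₀ ha, mul_comm] at this
  set τ := Real.sqrt (t ^ 2 + β ^ 2) with hτ
  have htτ : t ≤ τ := Real.le_sqrt_of_sq_le (by nlinarith)
  have hτt : τ ≤ t + β := by
    rw [hτ, Real.sqrt_le_left (by positivity)]; nlinarith
  have hτ0 : 0 < τ := ht0.trans_le htτ
  have hτm : τ ≤ (1 + β) * t := by nlinarith
  rw [integral_norm_macWeight ν ht0 ha, integral_macWeight ν hτ0 ha, norm_mul, norm_mul,
    Complex.norm_cpow_eq_rpow_re_of_pos (by positivity), Complex.norm_ofNat]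
  have hup := (hZ (a * t) htZ).2.2
  have hlo := (hZ (a * τ) (htZ.trans (by gcongr))).1.1
  set P := ‖besselK (ν.re : ℂ) ((a * t : ℝ) : ℂ)‖
  set Q := ‖besselK ν ((a * τ : ℝ) : ℂ)‖
  -- The factor `√x` is split off to pair with the `√z` that normalises the asymptotics of `K`.
  have e : ∀ x : ℝ, 0 < x → (a / (2 * x)) ^ ν.re =
      (a / 2) ^ ν.re * x ^ (-(ν.re + 1 / 2)) * Real.sqrt x := by
    intro x hx
    rw [show a / (2 * x) = a / 2 * x⁻¹ by field_simp, Real.mul_rpow (by positivity) (by positivity),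
      Real.sqrt_eq_rpow, mul_assoc, ← Real.rpow_add hx, Real.inv_rpow hx.le, ← Real.rpow_neg hx.le]
    congr 2; ring
  rw [e t ht0, e τ hτ0]
  rw [Real.sqrt_mul ha.le] at hup hlo
  have hp1 : t ^ (-(ν.re + 1 / 2)) ≤ (1 + β) ^ (ν.re + 1 / 2) * τ ^ (-(ν.re + 1 / 2)) := by
    rw [Real.rpow_neg ht0.le, Real.rpow_neg hτ0.le, ← div_eq_mul_inv, ← one_div,
      div_le_div_iff₀ (by positivity) (by positivity), one_mul,
      ← Real.mul_rpow (by positivity) ht0.le]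
    exact Real.rpow_le_rpow hτ0.le hτm hν
  have hsa := Real.sqrt_pos.2 ha
  have h1 : Real.sqrt t * P ≤ 2 * Real.exp (a * β) * (Real.sqrt τ * Q) := by
    have hE : Real.exp (a * τ) ≤ Real.exp (a * β) * Real.exp (a * t) := by
      rw [← Real.exp_add]; apply Real.exp_le_exp.2; nlinarith
    have hQ : 0 ≤ Real.sqrt a * (Real.sqrt τ * Q) := by positivity
    have hk : Real.sqrt a * Real.exp (a * t) * (Real.sqrt t * P) ≤
        Real.sqrt a * Real.exp (a * t) * (2 * Real.exp (a * β) * (Real.sqrt τ * Q)) := by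
      calc _ = Real.sqrt a * Real.sqrt t * Real.exp (a * t) * P := by ring
        _ ≤ 2 * 1 := by linarith
        _ ≤ 2 * (Real.sqrt a * Real.sqrt τ * Real.exp (a * τ) * Q) := by gcongr
        _ = 2 * (Real.exp (a * τ) * (Real.sqrt a * (Real.sqrt τ * Q))) := by ring
        _ ≤ 2 * ((Real.exp (a * β) * Real.exp (a * t)) * (Real.sqrt a * (Real.sqrt τ * Q))) := by
          gcongr
        _ = _ := by ring
    exact le_of_mul_le_mul_left hk (by positivity)
  calc _ = 2 * (a / 2) ^ ν.re * (t ^ (-(ν.re + 1 / 2)) * (Real.sqrt t * P)) := by ring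
    _ ≤ 2 * (a / 2) ^ ν.re * (((1 + β) ^ (ν.re + 1 / 2) * τ ^ (-(ν.re + 1 / 2))) *
        (2 * Real.exp (a * β) * (Real.sqrt τ * Q))) := by gcongr
    _ = _ := by ring

/-! ### The Gaussian-damped transform of the Hankel kernel -/

/-- The value of Weber's integral. -/
noncomputable def weberValue (μ : ℂ) (β c : ℝ) : ℂ :=
  1 / 2 * ((β / 2 : ℝ) : ℂ) ^ μ * ((1 / c : ℝ) : ℂ) ^ (μ + 1) *
    (Real.exp (-(β ^ 2 / (4 * c))) : ℂ)

theorem norm_weberValue (μ : ℂ) {β c : ℝ} (hβ : 0 < β) (hc : 0 < c) :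
    ‖weberValue μ β c‖ = 1 / 2 * (β / 2) ^ μ.re *
      ((1 / c) ^ (μ.re + 1) * Real.exp (-(β ^ 2 / 4 * (1 / c)))) := by
  rw [weberValue, norm_mul, norm_mul, norm_mul,
    Complex.norm_cpow_eq_rpow_re_of_pos (by positivity),
    Complex.norm_cpow_eq_rpow_re_of_pos (by positivity), Complex.norm_real,
    Real.norm_of_nonneg (Real.exp_pos _).le, Complex.add_re, Complex.one_re,
    show β ^ 2 / (4 * c) = β ^ 2 / 4 * (1 / c) by field_simp]
  norm_num
  ring

/-- This is `y ≤ exp y` at `y = bx/κ`, raised to the power `κ`. -/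
theorem rpow_mul_exp_neg_le {κ b x : ℝ} (hκ : 0 < κ) (hb : 0 < b) (hx : 0 < x) :
    x ^ κ * Real.exp (-(b * x)) ≤ (κ / b) ^ κ := by
  have h1 : b * x / κ ≤ Real.exp (b * x / κ) := by
    linarith [Real.add_one_le_exp (b * x / κ)]
  have h2 := Real.rpow_le_rpow (by positivity) h1 hκ.le
  rw [← Real.exp_mul, div_mul_cancel₀ _ hκ.ne'] at h2
  have h3 : x ^ κ = (κ / b) ^ κ * (b * x / κ) ^ κ := by
    rw [← Real.mul_rpow (by positivity) (by positivity)]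
    congr 1; field_simp
  rw [h3, Real.exp_neg, ← div_eq_mul_inv, div_le_iff₀ (Real.exp_pos _)]
  gcongr

/-- The value depends on `1/c` with `c = ε + 1/(4r)`. Its exponential factor tames large `1/c`,
giving the constant bound; `1/c ≤ 4r` gives the power bound. Neither depends on `ε`. -/
theorem exists_norm_weberValue_le {μ : ℂ} (hμ : -1 < μ.re) {β : ℝ} (hβ : 0 < β) :
    ∃ M : ℝ, 0 ≤ M ∧ ∀ ε r : ℝ, 0 ≤ ε → 0 < r → ‖weberValue μ β (ε + 1 / (4 * r))‖ ≤ M ∧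
      ‖weberValue μ β (ε + 1 / (4 * r))‖ ≤ M * r ^ (μ.re + 1) := by
  have hκ : 0 < μ.re + 1 := by linarith
  have hb : 0 < β ^ 2 / 4 := by positivity
  refine ⟨1 / 2 * (β / 2) ^ μ.re * (((μ.re + 1) / (β ^ 2 / 4)) ^ (μ.re + 1) + 4 ^ (μ.re + 1)),
    by positivity, fun ε r hε hr => ?_⟩
  have hc : 0 < ε + 1 / (4 * r) := by positivity
  rw [norm_weberValue μ hβ hc]
  have h1 := rpow_mul_exp_neg_le hκ hb (one_div_pos.2 hc)
  have h4 : (0 : ℝ) ≤ 4 ^ (μ.re + 1) := by positivity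
  have hA : 0 ≤ ((μ.re + 1) / (β ^ 2 / 4)) ^ (μ.re + 1) := by positivity
  constructor
  · exact mul_le_mul_of_nonneg_left (by linarith) (by positivity)
  · rw [mul_assoc (1 / 2 * (β / 2) ^ μ.re)]
    refine mul_le_mul_of_nonneg_left ?_ (by positivity)
    have h2 : 1 / (ε + 1 / (4 * r)) ≤ 4 * r := by
      rw [div_le_iff₀ hc]
      have : 4 * r * (ε + 1 / (4 * r)) = 4 * r * ε + 1 := by field_simp
      rw [this]
      have : 0 ≤ 4 * r * ε := by positivity
      linarith
    calc _ ≤ (4 * r) ^ (μ.re + 1) * 1 := by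
          gcongr
          rw [Real.exp_le_one_iff]
          exact neg_nonpos.2 (by positivity)
      _ = 4 ^ (μ.re + 1) * r ^ (μ.re + 1) := by
          rw [mul_one, Real.mul_rpow (by norm_num) hr.le]
      _ ≤ _ := by gcongr; linarith

/-- The kernel `z^(μ+1) J_μ(β z) exp(-ε z²)`. -/
noncomputable def dampedKernel (μ : ℂ) (β ε z : ℝ) : ℂ :=
  hankelKernel μ β z * (Real.exp (-(ε * z ^ 2)) : ℂ)

theorem integral_dampedKernel_mul_gaussian {μ : ℂ} (hμ : -1 < μ.re) {β ε r : ℝ} (hβ : 0 < β)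
    (hε : 0 < ε) (hr : 0 < r) :
    ∫ z in Ioi (0 : ℝ), dampedKernel μ β ε z * (Real.exp (-(z ^ 2 / (4 * r))) : ℂ) =
      weberValue μ β (ε + 1 / (4 * r)) := by
  have h := integral_hankelKernel_mul_gaussian hμ hβ
    (show 0 < ε + 1 / (4 * r) by positivity)
  rw [weberValue]
  push_cast at h ⊢
  rw [← h]
  congr 1
  ext z
  rw [dampedKernel, mul_assoc]
  push_cast
  rw [← Complex.exp_add]
  congr 2
  ring

theorem exists_norm_dampedTransform_le {μ : ℂ} (hμ : -1 < μ.re) {β a : ℝ} (hβ : 0 < β)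
    (ha : 0 < a) :
    ∃ C : ℝ, 0 ≤ C ∧ ∀ ε t : ℝ, 0 < ε → 0 < t →
      ‖∫ z in Ioi (0 : ℝ), dampedKernel μ β ε z * (yukawa a t z : ℂ)‖ ≤
        C * Real.exp (-(a * t)) ∧
      ‖∫ z in Ioi (0 : ℝ), dampedKernel μ β ε z * (yukawa a t z : ℂ)‖ ≤
        C * ∫ r in Ioi (0 : ℝ), ‖macWeight (μ + 1 / 2) t a r‖ := by
  obtain ⟨M, hM, h⟩ := exists_norm_weberValue_le hμ hβ
  refine ⟨M / a + M, by positivity, fun ε t hε ht => ⟨?_, ?_⟩⟩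
  · refine (norm_integral_mul_yukawa_le_exp (integrableOn_hankelKernel_mul_gaussian hμ hβ hε)
      ha ht (M := M) fun r hr => ?_).trans ?_
    · exact (congrArg norm (integral_dampedKernel_mul_gaussian hμ hβ hε hr)).trans_le
        (h ε r hε.le hr).1
    · gcongr; linarith
  · refine (norm_integral_mul_yukawa_le_macWeight
      (integrableOn_hankelKernel_mul_gaussian hμ hβ hε) ha ht (A := M) (κ := μ.re + 1)
      (fun r hr => ?_) (μ + 1 / 2) ?_).trans ?_
    · exact (congrArg norm (integral_dampedKernel_mul_gaussian hμ hβ hε hr)).trans_le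
        (h ε r hε.le hr).2
    · norm_num; ring
    · have : 0 ≤ ∫ r in Ioi (0 : ℝ), ‖macWeight (μ + 1 / 2) t a r‖ :=
        integral_nonneg fun r => norm_nonneg _
      gcongr
      have : 0 ≤ M / a := by positivity
      linarith

/-- The absolute version, needed only for Fubini at fixed `ε`, so `C` may depend on `ε`. The kernel
is replaced by a positive majorant whose Gaussian transforms are Gamma integrals; the parameter `ε/2
+ 1/(4r)` is bounded below by either summand, which gives the two estimates. -/
theorem exists_integral_norm_dampedKernel_le {μ : ℂ} (hμ : -1 < μ.re) {β a ε : ℝ} (hβ : 0 < β)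
    (ha : 0 < a) (hε : 0 < ε) :
    ∃ C : ℝ, 0 ≤ C ∧ ∀ t : ℝ, 0 < t →
      ∫ z in Ioi (0 : ℝ), ‖dampedKernel μ β ε z‖ * yukawa a t z ≤ C * Real.exp (-(a * t)) ∧
      ∫ z in Ioi (0 : ℝ), ‖dampedKernel μ β ε z‖ * yukawa a t z ≤
        C * ∫ r in Ioi (0 : ℝ), ‖macWeight (μ + 1 / 2) t a r‖ := by
  obtain ⟨C, hC, hk⟩ := exists_hankelKernel_le hμ hβ (half_pos hε)
  have hκ : 0 < μ.re + 1 := by linarith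
  -- The majorant is made complex so that the subordination lemmas apply; its exponent is `2 Re μ +
  -- 1`.
  set h : ℝ → ℂ := fun z => C * ((z : ℂ) ^ (2 * ((μ.re + 1 : ℝ) : ℂ) - 1) *
    (Real.exp (-(ε / 2 * z ^ 2)) : ℂ)) with hh
  have hreal : ∀ z : ℝ, 0 < z →
      h z = ((C * (z ^ (2 * μ.re + 1) * Real.exp (-(ε / 2 * z ^ 2))) : ℝ) : ℂ) := by
    intro z hz
    simp only [hh]
    rw [Complex.ofReal_mul, Complex.ofReal_mul, Complex.ofReal_cpow hz.le]
    congr 3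
    push_cast; ring
  have hint : IntegrableOn (fun z : ℝ => C * (z ^ (2 * μ.re + 1) *
      Real.exp (-(ε / 2 * z ^ 2)))) (Ioi 0) := by
    have := (integrableOn_rpow_mul_exp_neg_mul_sq (half_pos hε) (s := 2 * μ.re + 1)
      (by linarith)).const_mul C
    simp only [neg_mul] at this
    exact this
  have hhint : IntegrableOn h (Ioi 0) := by
    refine hint.ofReal.congr ?_
    filter_upwards [ae_restrict_mem measurableSet_Ioi] with z hz using (hreal z hz).symm
  have hgauss : ∀ r : ℝ, 0 < r →
      ‖∫ z in Ioi (0 : ℝ), h z * (Real.exp (-(z ^ 2 / (4 * r))) : ℂ)‖ =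
        C * (1 / 2 * (1 / (ε / 2 + 1 / (4 * r))) ^ (μ.re + 1) * Real.Gamma (μ.re + 1)) := by
    intro r hr
    have hc : 0 < ε / 2 + 1 / (4 * r) := by positivity
    have h1 := integral_cpow_mul_gaussian (w := ((μ.re + 1 : ℝ) : ℂ)) (by simpa using hκ) hc
    have h2 : ∫ z in Ioi (0 : ℝ), h z * (Real.exp (-(z ^ 2 / (4 * r))) : ℂ) =
        C * ∫ z in Ioi (0 : ℝ), (z : ℂ) ^ (2 * ((μ.re + 1 : ℝ) : ℂ) - 1) *
          (Real.exp (-((ε / 2 + 1 / (4 * r)) * z ^ 2)) : ℂ) := by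
      rw [← integral_const_mul]
      congr 1
      ext z
      simp only [hh]
      rw [mul_assoc, mul_assoc, ← Complex.ofReal_mul, ← Real.exp_add]
      congr 4
      ring
    rw [h2, h1, Complex.Gamma_ofReal, norm_mul, norm_mul, norm_mul, ← Complex.ofReal_one,
      ← Complex.ofReal_div, Complex.norm_cpow_eq_rpow_re_of_pos (by positivity), Complex.norm_real,
      Complex.norm_real, Real.norm_of_nonneg hC, Real.norm_of_nonneg (Real.Gamma_pos_of_pos hκ).le,
      Complex.ofReal_re]
    norm_num
  have hmono : ∀ t : ℝ, 0 < t → ∫ z in Ioi (0 : ℝ), ‖dampedKernel μ β ε z‖ * yukawa a t z ≤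
      ‖∫ z in Ioi (0 : ℝ), h z * (yukawa a t z : ℂ)‖ := by
    intro t ht
    have hgi : IntegrableOn (fun z : ℝ => C * (z ^ (2 * μ.re + 1) *
        Real.exp (-(ε / 2 * z ^ 2))) * yukawa a t z) (Ioi 0) :=
      hint.mul_bdd (c := 1 / a) (((measurable_yukawa a).comp
        (measurable_const.prodMk measurable_id)).aestronglyMeasurable)
        (Eventually.of_forall fun z => by
          rw [Real.norm_of_nonneg (yukawa_nonneg _ _ _)]; exact yukawa_le ha ht z)
    have heq : ∫ z in Ioi (0 : ℝ), h z * (yukawa a t z : ℂ) =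
        ((∫ z in Ioi (0 : ℝ), C * (z ^ (2 * μ.re + 1) *
          Real.exp (-(ε / 2 * z ^ 2))) * yukawa a t z : ℝ) : ℂ) := by
      rw [← integral_complex_ofReal]
      refine setIntegral_congr_fun measurableSet_Ioi fun z hz => ?_
      simp only [hreal z hz]
      push_cast; rfl
    rw [heq, Complex.norm_real]
    refine le_trans ?_ (le_abs_self _)
    refine integral_mono_of_nonneg (Eventually.of_forall fun z =>
      mul_nonneg (norm_nonneg _) (yukawa_nonneg _ _ _)) hgi ?_
    filter_upwards [ae_restrict_mem measurableSet_Ioi] with z (hz : 0 < z)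
    refine mul_le_mul_of_nonneg_right ?_ (yukawa_nonneg _ _ _)
    rw [dampedKernel, norm_mul, Complex.norm_real, Real.norm_of_nonneg (Real.exp_pos _).le]
    calc _ ≤ C * (z ^ (2 * μ.re + 1) * Real.exp (ε / 2 * z ^ 2)) * Real.exp (-(ε * z ^ 2)) := by
          gcongr; exact hk z hz
      _ = _ := by
          rw [mul_assoc, mul_assoc, ← Real.exp_add]; ring_nf
  have hΓ := Real.Gamma_pos_of_pos hκ
  set A := C * (1 / 2 * (2 / ε) ^ (μ.re + 1) * Real.Gamma (μ.re + 1)) with hA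
  set B := C * (1 / 2 * 4 ^ (μ.re + 1) * Real.Gamma (μ.re + 1)) with hB
  have hA0 : 0 ≤ A := by positivity
  have hB0 : 0 ≤ B := by positivity
  refine ⟨A / a + B, by positivity, fun t ht =>
    ⟨(hmono t ht).trans ((norm_integral_mul_yukawa_le_exp hhint ha ht (M := A)
      fun r hr => ?_).trans ?_), (hmono t ht).trans ((norm_integral_mul_yukawa_le_macWeight hhint
        ha ht (A := B) (κ := μ.re + 1) (fun r hr => ?_) (μ + 1 / 2) ?_).trans ?_)⟩⟩
  · rw [hgauss r hr, hA]
    have : 1 / (ε / 2 + 1 / (4 * r)) ≤ 2 / ε := by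
      rw [div_le_div_iff₀ (by positivity) hε]
      have : 0 < 1 / (4 * r) := by positivity
      linarith
    gcongr
  · gcongr; linarith
  · rw [hgauss r hr, hB]
    have : 1 / (ε / 2 + 1 / (4 * r)) ≤ 4 * r := by
      rw [div_le_iff₀ (by positivity)]
      have : 4 * r * (ε / 2 + 1 / (4 * r)) = 2 * r * ε + 1 := by field_simp; ring
      rw [this]
      have : 0 < 2 * r * ε := by positivity
      linarith
    calc _ ≤ C * (1 / 2 * (4 * r) ^ (μ.re + 1) * Real.Gamma (μ.re + 1)) := by gcongr
      _ = _ := by rw [Real.mul_rpow (by norm_num) hr.le]; ring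
  · norm_num; ring
  · have : 0 ≤ ∫ r in Ioi (0 : ℝ), ‖macWeight (μ + 1 / 2) t a r‖ :=
      integral_nonneg fun r => norm_nonneg _
    gcongr
    have : 0 ≤ A / a := by positivity
    linarith

/-- Without damping `1/c = 4r`: the power `(4r)^(μ+1)` raises the order from `-1/2` to `μ + 1/2`,
and `exp(-β²r)` changes `t²` into `t² + β²`. -/
theorem macWeight_mul_weberValue (μ : ℂ) {β t a r : ℝ} (hr : 0 < r) :
    macWeight (-(1 / 2)) t a r * weberValue μ β (1 / (4 * r)) =
      1 / 2 * ((β / 2 : ℝ) : ℂ) ^ μ * (4 : ℂ) ^ (μ + 1) *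
        macWeight (μ + 1 / 2) (Real.sqrt (t ^ 2 + β ^ 2)) a r := by
  have hr' : (r : ℂ) ≠ 0 := by exact_mod_cast hr.ne'
  have h1 : ((1 / (1 / (4 * r)) : ℝ) : ℂ) ^ (μ + 1) = (4 : ℂ) ^ (μ + 1) * (r : ℂ) ^ (μ + 1) := by
    rw [one_div_one_div, Complex.ofReal_mul, Complex.mul_cpow_ofReal_nonneg (by norm_num) hr.le]
    norm_num
  have h2 : (r : ℂ) ^ (μ + 1 / 2 - 1) = (r : ℂ) ^ (-(1 / 2) - 1 : ℂ) * (r : ℂ) ^ (μ + 1) := by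
    rw [← Complex.cpow_add _ _ hr']; congr 1; ring
  have h3 : Real.exp (-((t ^ 2 + β ^ 2) * r + a ^ 2 / (4 * r))) =
      Real.exp (-(t ^ 2 * r + a ^ 2 / (4 * r))) * Real.exp (-(β ^ 2 / (4 * (1 / (4 * r))))) := by
    rw [← Real.exp_add]; congr 1; field_simp; ring
  rw [macWeight, macWeight, weberValue, Real.sq_sqrt (by positivity), h1, h2, h3]
  push_cast
  ring

theorem integral_macWeight_sqrt (μ : ℂ) {β t a : ℝ} (hβ : 0 < β) (ha : 0 < a) :
    ∫ r in Ioi (0 : ℝ), macWeight (μ + 1 / 2) (Real.sqrt (t ^ 2 + β ^ 2)) a r =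
      2 * ((a / 2 : ℝ) : ℂ) ^ (μ + 1 / 2) * (((t ^ 2 + β ^ 2 : ℝ) : ℂ) ^ (-μ / 2 - 1 / 4) *
        besselK (μ + 1 / 2) ((2 * a * Real.sqrt (t ^ 2 + β ^ 2) / 2 : ℝ) : ℂ)) := by
  have hS : 0 < t ^ 2 + β ^ 2 := by positivity
  have hτ := Real.sqrt_pos.2 hS
  have hτ' : (Real.sqrt (t ^ 2 + β ^ 2) : ℂ) ≠ 0 := by exact_mod_cast hτ.ne'
  rw [integral_macWeight _ hτ ha, mul_assoc 2 a, mul_div_cancel_left₀ _ two_ne_zero]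
  have h1 : ((t ^ 2 + β ^ 2 : ℝ) : ℂ) ^ (-μ / 2 - 1 / 4) =
      (Real.sqrt (t ^ 2 + β ^ 2) : ℂ) ^ (-(μ + 1 / 2)) := by
    conv_lhs => rw [← Real.sq_sqrt hS.le, ← Real.rpow_two,
      ← Complex.cpow_mul_ofReal_nonneg hτ.le]
    congr 1; push_cast; ring
  have h2 : ((a / (2 * Real.sqrt (t ^ 2 + β ^ 2)) : ℝ) : ℂ) ^ (μ + 1 / 2) =
      ((a / 2 : ℝ) : ℂ) ^ (μ + 1 / 2) * (Real.sqrt (t ^ 2 + β ^ 2) : ℂ) ^ (-(μ + 1 / 2)) := by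
    rw [Complex.cpow_neg, ← Complex.inv_cpow _ _ (by
      rw [Complex.arg_ofReal_of_nonneg hτ.le]; exact Real.pi_pos.ne), ← Complex.ofReal_inv,
      ← Complex.mul_cpow_ofReal_nonneg (by positivity) (by positivity), ← Complex.ofReal_mul]
    congr 2; field_simp
  rw [h1, h2]
  ring

/-- After subordination `ε` enters only through Weber's value, which is continuous in its parameter
and bounded uniformly in `ε`, so the integrable weight dominates. -/
theorem tendsto_dampedTransform {μ : ℂ} (hμ : -1 < μ.re) {β a t : ℝ} (hβ : 0 < β) (ha : 0 < a)
    (ht : 0 < t) :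
    Tendsto (fun ε : ℝ => ∫ z in Ioi (0 : ℝ), dampedKernel μ β ε z * (yukawa a t z : ℂ)) (𝓝[>] 0)
      (𝓝 (1 / (2 * Real.sqrt Real.pi : ℂ) * (1 / 2 * ((β / 2 : ℝ) : ℂ) ^ μ * (4 : ℂ) ^ (μ + 1) *
        ∫ r in Ioi (0 : ℝ), macWeight (μ + 1 / 2) (Real.sqrt (t ^ 2 + β ^ 2)) a r))) := by
  obtain ⟨M, hM, hb⟩ := exists_norm_weberValue_le hμ hβ
  rw [← integral_const_mul]
  have hcongr : ∫ r in Ioi (0 : ℝ), 1 / 2 * ((β / 2 : ℝ) : ℂ) ^ μ * (4 : ℂ) ^ (μ + 1) *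
      macWeight (μ + 1 / 2) (Real.sqrt (t ^ 2 + β ^ 2)) a r =
      ∫ r in Ioi (0 : ℝ), macWeight (-(1 / 2)) t a r * weberValue μ β (1 / (4 * r)) :=
    setIntegral_congr_fun measurableSet_Ioi fun r hr => (macWeight_mul_weberValue μ hr).symm
  rw [hcongr]
  have hlim : Tendsto (fun ε : ℝ => ∫ r in Ioi (0 : ℝ), macWeight (-(1 / 2)) t a r *
      weberValue μ β (ε + 1 / (4 * r))) (𝓝[>] 0)
      (𝓝 (∫ r in Ioi (0 : ℝ), macWeight (-(1 / 2)) t a r * weberValue μ β (1 / (4 * r)))) := by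
    refine tendsto_integral_filter_of_dominated_convergence
      (fun r => ‖macWeight (-(1 / 2)) t a r‖ * M) ?_ ?_
      ((integrableOn_macWeight _ ht ha).norm.mul_const M) ?_
    · refine Eventually.of_forall fun ε => ?_
      refine (integrableOn_macWeight _ ht ha).aestronglyMeasurable.mul ?_
      apply Measurable.aestronglyMeasurable
      unfold weberValue
      fun_prop
    · filter_upwards [self_mem_nhdsWithin] with ε (hε : 0 < ε)
      filter_upwards [ae_restrict_mem measurableSet_Ioi] with r hr
      rw [norm_mul]
      gcongr
      exact (hb ε r hε.le hr).1
    · filter_upwards [ae_restrict_mem measurableSet_Ioi] with r (hr : 0 < r)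
      refine Tendsto.const_mul _ ?_
      have hc : 0 < 1 / (4 * r) := by positivity
      have hcont : ContinuousAt (weberValue μ β) (1 / (4 * r)) := by
        have hdiv : ContinuousAt (fun c : ℝ => ((1 / c : ℝ) : ℂ)) (1 / (4 * r)) :=
          Complex.continuous_ofReal.continuousAt.comp (continuousAt_const.div continuousAt_id hc.ne')
        unfold weberValue
        refine (continuousAt_const.mul (hdiv.cpow continuousAt_const ?_)).mul ?_
        · exact Complex.ofReal_mem_slitPlane.2 (one_div_pos.2 hc)
        · refine Complex.continuous_ofReal.continuousAt.comp
            (Real.continuous_exp.continuousAt.comp (ContinuousAt.neg ?_))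
          exact continuousAt_const.div (continuousAt_const.mul continuousAt_id)
            (mul_pos four_pos hc).ne'
      have hadd : Tendsto (fun ε : ℝ => ε + 1 / (4 * r)) (𝓝[>] 0) (𝓝 (1 / (4 * r))) := by
        have : Tendsto (fun ε : ℝ => ε + 1 / (4 * r)) (𝓝 0) (𝓝 (0 + 1 / (4 * r))) :=
          tendsto_id.add_const _
        rw [zero_add] at this
        exact this.mono_left nhdsWithin_le_nhds
      exact hcont.tendsto.comp hadd
  refine (hlim.const_mul _).congr' ?_
  filter_upwards [self_mem_nhdsWithin] with ε (hε : 0 < ε)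
  have h1 := integral_mul_yukawa
    (h := dampedKernel μ β ε) (integrableOn_hankelKernel_mul_gaussian hμ hβ hε) ha ht
  rw [h1]
  congr 1
  exact setIntegral_congr_fun measurableSet_Ioi fun r hr => by
    rw [integral_dampedKernel_mul_gaussian hμ hβ hε hr]

/-! ### Gaussian summation of improper integrals -/

theorem HasImproperIntegral.exists_bound {f : ℝ → ℂ} {L : ℂ} (hf : HasImproperIntegral f 0 L) :
    ∃ M : ℝ, ∀ R, 0 ≤ R → ‖∫ x in (0 : ℝ)..R, f x‖ ≤ M := by
  obtain ⟨h1, h2⟩ := hf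
  obtain ⟨R₀, hR₀⟩ := eventually_atTop.1
    (h2.norm.eventually (gt_mem_nhds (lt_add_one ‖L‖)))
  set R₁ := max R₀ 1
  have hc : ContinuousOn (fun R => ∫ x in (0 : ℝ)..R, f x) (uIcc 0 R₁) :=
    intervalIntegral.continuousOn_primitive_interval' (h1 R₁ (by positivity)) left_mem_uIcc
  obtain ⟨M, hM⟩ := isCompact_uIcc.exists_bound_of_continuousOn hc
  refine ⟨max M (‖L‖ + 1), fun R hR => ?_⟩
  rcases le_total R R₁ with h | h
  · exact (hM R (by rw [uIcc_of_le (by positivity)]; exact ⟨hR, h⟩)).trans (le_max_left _ _)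
  · exact (hR₀ R ((le_max_left _ _).trans h)).le.trans (le_max_right _ _)

/-- Writing `exp(-εz²)` as the integral of `exp(-v)` over `v > εz²` and swapping, the damped
integral becomes the average against `exp(-v)` of the partial integrals of `f` up to `√(v/ε)`. These
are bounded and tend to `L`, so dominated convergence applies. -/
theorem HasImproperIntegral.tendsto_gaussian {f : ℝ → ℂ} {L : ℂ} (hf : HasImproperIntegral f 0 L)
    (hi : ∀ ε : ℝ, 0 < ε →
      IntegrableOn (fun z => f z * (Real.exp (-(ε * z ^ 2)) : ℂ)) (Ioi 0)) :
    Tendsto (fun ε : ℝ => ∫ z in Ioi (0 : ℝ), f z * (Real.exp (-(ε * z ^ 2)) : ℂ)) (𝓝[>] 0)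
      (𝓝 L) := by
  -- Measurability of `f` is recovered by undoing the damping at `ε = 1`.
  have hmeas : AEStronglyMeasurable f (volume.restrict (Ioi 0)) := by
    refine ((hi 1 one_pos).aestronglyMeasurable.mul
      (Measurable.aestronglyMeasurable (f := fun z : ℝ => (Real.exp (1 * z ^ 2) : ℂ))
        (by fun_prop))).congr (Eventually.of_forall fun z => ?_)
    change f z * (Real.exp (-(1 * z ^ 2)) : ℂ) * (Real.exp (1 * z ^ 2) : ℂ) = f z
    rw [mul_assoc, ← Complex.ofReal_mul, ← Real.exp_add]
    simp
  set K : ℝ → ℝ → ℝ → ℂ := fun ε z v =>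
    {x : ℝ × ℝ | ε * x.1 ^ 2 < x.2}.indicator (fun x => f x.1 * (Real.exp (-x.2) : ℂ)) (z, v)
    with hK
  have hKv : ∀ ε z, 0 < ε → (fun v => K ε z v) =
      (Ioi (ε * z ^ 2)).indicator (fun v => f z * (Real.exp (-v) : ℂ)) := by
    intro ε z hε
    ext v
    simp only [hK, indicator_apply, mem_ofPred_eq, mem_Ioi]
  have hKz : ∀ ε v : ℝ, 0 < ε → 0 < v → ∫ z in Ioi (0 : ℝ), K ε z v =
      (∫ z in (0 : ℝ)..Real.sqrt (v / ε), f z) * (Real.exp (-v) : ℂ) := by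
    intro ε v hε hv
    have hs := Real.sqrt_nonneg (v / ε)
    rw [intervalIntegral.integral_of_le hs, ← integral_mul_const,
      integral_Ioc_eq_integral_Ioo, ← integral_indicator measurableSet_Ioi,
      ← integral_indicator measurableSet_Ioo]
    congr 1
    ext z
    simp only [hK, indicator_apply, mem_ofPred_eq, mem_Ioi, mem_Ioo]
    by_cases hz : 0 < z
    · have : ε * z ^ 2 < v ↔ z < Real.sqrt (v / ε) := by
        rw [Real.lt_sqrt hz.le, lt_div_iff₀ hε, mul_comm]
      simp [hz, this]
    · simp [hz]
  have hprod : ∀ ε : ℝ, 0 < ε → Integrable (Function.uncurry (K ε))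
      ((volume.restrict (Ioi (0 : ℝ))).prod (volume.restrict (Ioi (0 : ℝ)))) := by
    intro ε hε
    have hm : AEStronglyMeasurable (Function.uncurry (K ε))
        ((volume.restrict (Ioi (0 : ℝ))).prod (volume.restrict (Ioi (0 : ℝ)))) := by
      have : Function.uncurry (K ε) = {x : ℝ × ℝ | ε * x.1 ^ 2 < x.2}.indicator
          (fun x => f x.1 * (Real.exp (-x.2) : ℂ)) := by
        ext x; rfl
      rw [this]
      refine AEStronglyMeasurable.indicator (hmeas.comp_fst.mul
        (Measurable.aestronglyMeasurable (by fun_prop))) ?_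
      exact measurableSet_lt (by fun_prop) (by fun_prop)
    rw [integrable_prod_iff hm]
    have hexp : ∀ z : ℝ, IntegrableOn (fun v : ℝ => f z * (Real.exp (-v) : ℂ))
        (Ioi (ε * z ^ 2)) := fun z => ((integrableOn_exp_neg_Ioi _).ofReal).const_mul _
    have hsub : ∀ z : ℝ, Ioi (ε * z ^ 2) ⊆ Ioi 0 := fun z =>
      Ioi_subset_Ioi (by positivity)
    constructor
    · refine Eventually.of_forall fun z => ?_
      change Integrable (fun v => K ε z v) _
      rw [hKv ε z hε, integrable_indicator_iff measurableSet_Ioi]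
      exact Integrable.mono_measure (hexp z) (Measure.restrict_mono le_rfl Measure.restrict_le_self)
    · refine (hi ε hε).norm.congr (Eventually.of_forall fun z => ?_)
      change _ = ∫ v in Ioi (0 : ℝ), ‖K ε z v‖
      have : (fun v => ‖K ε z v‖) = (Ioi (ε * z ^ 2)).indicator
          (fun v => ‖f z‖ * Real.exp (-v)) := by
        ext v
        rw [congrFun (hKv ε z hε) v, norm_indicator_eq_indicator_norm]
        simp only [indicator_apply, norm_mul, Complex.norm_real, Real.norm_eq_abs, Real.abs_exp]
      rw [this, setIntegral_indicator measurableSet_Ioi, inter_eq_right.2 (hsub z),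
        integral_const_mul, integral_exp_neg_Ioi]
      change ‖f z * (Real.exp (-(ε * z ^ 2)) : ℂ)‖ = _
      rw [norm_mul, Complex.norm_real, Real.norm_of_nonneg (Real.exp_pos _).le]
  have hrew : ∀ ε : ℝ, 0 < ε → ∫ z in Ioi (0 : ℝ), f z * (Real.exp (-(ε * z ^ 2)) : ℂ) =
      ∫ v in Ioi (0 : ℝ), ∫ z in Ioi (0 : ℝ), K ε z v := by
    intro ε hε
    rw [← integral_integral_swap (hprod ε hε)]
    congr 1
    ext z
    rw [hKv ε z hε, setIntegral_indicator measurableSet_Ioi,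
      inter_eq_right.2 (Ioi_subset_Ioi (by positivity)), integral_const_mul,
      integral_complex_ofReal, integral_exp_neg_Ioi]
  obtain ⟨M, hM⟩ := HasImproperIntegral.exists_bound hf
  have hL : L = ∫ v in Ioi (0 : ℝ), L * (Real.exp (-v) : ℂ) := by
    rw [integral_const_mul, integral_complex_ofReal, integral_exp_neg_Ioi_zero]
    simp
  rw [hL]
  refine (tendsto_integral_filter_of_dominated_convergence
    (F := fun ε v => ∫ z in Ioi (0 : ℝ), K ε z v)
    (fun v : ℝ => M * Real.exp (-v)) ?_ ?_ ((integrableOn_exp_neg_Ioi 0).const_mul M) ?_).congr' ?_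
  · filter_upwards [self_mem_nhdsWithin] with ε hε
    exact (hprod ε hε).integral_prod_right.aestronglyMeasurable
  · filter_upwards [self_mem_nhdsWithin] with ε hε
    filter_upwards [ae_restrict_mem measurableSet_Ioi] with v hv
    rw [hKz ε v hε hv, norm_mul, Complex.norm_real, Real.norm_of_nonneg (Real.exp_pos _).le]
    gcongr
    exact hM _ (Real.sqrt_nonneg _)
  · filter_upwards [ae_restrict_mem measurableSet_Ioi] with v (hv : 0 < v)
    have ht : Tendsto (fun ε : ℝ => Real.sqrt (v / ε)) (𝓝[>] 0) atTop := by
      have h : Tendsto (fun ε : ℝ => v / ε) (𝓝[>] 0) atTop :=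
        tendsto_inv_nhdsGT_zero.const_mul_atTop hv
      exact Real.tendsto_sqrt_atTop.comp h
    refine ((hf.2.comp ht).mul_const _).congr' ?_
    filter_upwards [self_mem_nhdsWithin] with ε hε
    exact (hKz ε v hε hv).symm
  · filter_upwards [self_mem_nhdsWithin] with ε hε
    exact (hrew ε hε).symm

/-! ### Dominating the inverse Laplace transform -/

section
variable {μ : ℂ} {β q a : ℝ} {F G : ℝ → ℂ}

theorem macdonaldIntegrand_eq (hβ : 0 < β) (ha : 0 < a) (t : ℝ) :
    macdonaldIntegrand μ β q (2 * a) G t = (2 * ((a / 2 : ℝ) : ℂ) ^ (μ + 1 / 2))⁻¹ *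
      ((Real.exp (-(q * t)) : ℂ) * G t *
        ∫ r in Ioi (0 : ℝ), macWeight (μ + 1 / 2) (Real.sqrt (t ^ 2 + β ^ 2)) a r) := by
  have h : ((a / 2 : ℝ) : ℂ) ^ (μ + 1 / 2) ≠ 0 := by
    rw [Complex.cpow_ne_zero_iff]
    left
    exact_mod_cast (by positivity : a / 2 ≠ 0)
  rw [integral_macWeight_sqrt μ hβ ha, macdonaldIntegrand]
  generalize ((a / 2 : ℝ) : ℂ) ^ (μ + 1 / 2) = A at h
  rw [mul_assoc _ _ (besselK _ _)]
  generalize ((t ^ 2 + β ^ 2 : ℝ) : ℂ) ^ (-μ / 2 - 1 / 4) * besselK _ _ = B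
  field_simp

/-- Stated for an abstract number `X` so that the same `b` serves Fubini at fixed `ε` and the limit
`ε → 0`, where `C` is uniform. -/
theorem exists_majorant (hμ : -1 < μ.re) (hβ : 0 < β) (ha : 0 < a)
    (hFG : IsInverseLaplace G F (q + a))
    (hG : IntegrableOn (macdonaldIntegrand μ β q (2 * a) G) (Ioi 0)) :
    ∃ b : ℝ → ℝ, IntegrableOn b (Ioi 0) ∧ ∀ t X C : ℝ, 0 < t → 0 ≤ C →
      X ≤ C * Real.exp (-(a * t)) →
      X ≤ C * ∫ r in Ioi (0 : ℝ), ‖macWeight (μ + 1 / 2) t a r‖ →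
      ‖(Real.exp (-(q * t)) : ℂ) * G t‖ * X ≤ C * b t := by
  obtain ⟨T, D, hT, hD, hdom⟩ := exists_integral_norm_macWeight_le (μ + 1 / 2) (a := a) (β := β)
    (by norm_num; linarith) ha hβ
  -- Absolute convergence is available only strictly to the right of `q + a`; moving one unit costs
  -- `exp t`, at most `exp T` on `t ≤ T`.
  have hlap := (hFG (q + a + 1) (by linarith)).1
  set κ : ℂ := (2 * ((a / 2 : ℝ) : ℂ) ^ (μ + 1 / 2))⁻¹ with hκ
  have hκ0 : κ ≠ 0 := by
    apply inv_ne_zero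
    apply mul_ne_zero two_ne_zero
    rw [Complex.cpow_ne_zero_iff]
    left
    exact_mod_cast (by positivity : a / 2 ≠ 0)
  refine ⟨fun t => Real.exp T * ‖(Real.exp (-((q + a + 1) * t)) : ℂ) * G t‖ +
    D * ‖κ‖⁻¹ * ‖macdonaldIntegrand μ β q (2 * a) G t‖,
    (hlap.norm.const_mul _).add (hG.norm.const_mul _), fun t X C ht hC h1 h2 => ?_⟩
  have hn : ∀ x : ℝ, ‖(Real.exp x : ℂ)‖ = Real.exp x := fun x => by
    rw [Complex.norm_real, Real.norm_of_nonneg (Real.exp_pos _).le]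
  rcases le_total t T with htT | htT
  · calc ‖(Real.exp (-(q * t)) : ℂ) * G t‖ * X
        ≤ ‖(Real.exp (-(q * t)) : ℂ) * G t‖ * (C * Real.exp (-(a * t))) := by gcongr
      _ = C * (Real.exp t * ‖(Real.exp (-((q + a + 1) * t)) : ℂ) * G t‖) := by
        rw [norm_mul, norm_mul, hn, hn]
        have : Real.exp (-(q * t)) * Real.exp (-(a * t)) =
            Real.exp t * Real.exp (-((q + a + 1) * t)) := by
          rw [← Real.exp_add, ← Real.exp_add]; congr 1; ring
        linear_combination C * ‖G t‖ * this
      _ ≤ _ := by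
        refine mul_le_mul_of_nonneg_left ?_ hC
        refine (mul_le_mul_of_nonneg_right (Real.exp_le_exp.2 htT) (norm_nonneg _)).trans
          (le_add_of_nonneg_right (by positivity))
  · have hκn := norm_pos_iff.2 hκ0
    calc ‖(Real.exp (-(q * t)) : ℂ) * G t‖ * X
        ≤ ‖(Real.exp (-(q * t)) : ℂ) * G t‖ * (C * (D *
          ‖∫ r in Ioi (0 : ℝ), macWeight (μ + 1 / 2) (Real.sqrt (t ^ 2 + β ^ 2)) a r‖)) := by
          gcongr
          exact h2.trans (mul_le_mul_of_nonneg_left (hdom t htT) hC)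
      _ = C * (D * ‖κ‖⁻¹ * ‖macdonaldIntegrand μ β q (2 * a) G t‖) := by
          rw [macdonaldIntegrand_eq hβ ha, norm_mul κ, norm_mul _ (∫ r in Ioi (0 : ℝ), _)]
          field_simp
      _ ≤ _ := by
          refine mul_le_mul_of_nonneg_left ?_ hC
          exact le_add_of_nonneg_left (by positivity)

theorem integrable_dampedKernel_mul_yukawa_prod (hμ : -1 < μ.re) (hβ : 0 < β) (ha : 0 < a)
    (hFG : IsInverseLaplace G F (q + a))
    (hG : IntegrableOn (macdonaldIntegrand μ β q (2 * a) G) (Ioi 0)) {ε : ℝ} (hε : 0 < ε) :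
    Integrable (Function.uncurry fun z t : ℝ => dampedKernel μ β ε z * (yukawa a t z : ℂ) *
      ((Real.exp (-(q * t)) : ℂ) * G t))
      ((volume.restrict (Ioi (0 : ℝ))).prod (volume.restrict (Ioi (0 : ℝ)))) := by
  obtain ⟨b, hb, hmaj⟩ := exists_majorant hμ hβ ha hFG hG
  obtain ⟨C, hC, hbd⟩ := exists_integral_norm_dampedKernel_le hμ hβ ha hε
  have hk := integrableOn_hankelKernel_mul_gaussian hμ hβ hε
  have hGm : AEStronglyMeasurable (fun t : ℝ => (Real.exp (-(q * t)) : ℂ) * G t)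
      (volume.restrict (Ioi 0)) := by
    refine ((hFG (q + a + 1) (by linarith)).1.aestronglyMeasurable.mul
      (Measurable.aestronglyMeasurable (f := fun t : ℝ => (Real.exp ((a + 1) * t) : ℂ))
        (by fun_prop))).congr (Eventually.of_forall fun t => ?_)
    change (Real.exp (-((q + a + 1) * t)) : ℂ) * G t * (Real.exp ((a + 1) * t) : ℂ) = _
    rw [mul_right_comm, ← Complex.ofReal_mul, ← Real.exp_add]
    congr 3; ring
  have hym : Measurable fun x : ℝ × ℝ => (yukawa a x.2 x.1 : ℂ) :=
    Complex.measurable_ofReal.comp ((measurable_yukawa a).comp measurable_swap)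
  have hm : AEStronglyMeasurable (Function.uncurry fun z t : ℝ =>
      dampedKernel μ β ε z * (yukawa a t z : ℂ) * ((Real.exp (-(q * t)) : ℂ) * G t))
      ((volume.restrict (Ioi (0 : ℝ))).prod (volume.restrict (Ioi (0 : ℝ)))) := by
    refine (AEStronglyMeasurable.mul ?_ hym.aestronglyMeasurable).mul hGm.comp_snd
    exact AEStronglyMeasurable.comp_fst (f := dampedKernel μ β ε) hk.aestronglyMeasurable
  rw [integrable_prod_iff' hm]
  constructor
  · filter_upwards [ae_restrict_mem measurableSet_Ioi] with t ht
    have hyt : Measurable fun z : ℝ => (yukawa a t z : ℂ) :=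
      hym.comp (measurable_id.prodMk measurable_const)
    have h1 : IntegrableOn (fun z => dampedKernel μ β ε z * (yukawa a t z : ℂ)) (Ioi 0) := by
      refine Integrable.mul_bdd (c := 1 / a) hk hyt.aestronglyMeasurable
        (Eventually.of_forall fun z => ?_)
      rw [Complex.norm_real, Real.norm_of_nonneg (yukawa_nonneg _ _ _)]
      exact yukawa_le ha ht z
    exact h1.mul_const ((Real.exp (-(q * t)) : ℂ) * G t)
  · refine (hb.const_mul C).mono' hm.norm.prod_swap.integral_prod_right' ?_
    filter_upwards [ae_restrict_mem measurableSet_Ioi] with t ht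
    have : ∫ z in Ioi (0 : ℝ), ‖Function.uncurry (fun z t : ℝ =>
        dampedKernel μ β ε z * (yukawa a t z : ℂ) * ((Real.exp (-(q * t)) : ℂ) * G t)) (z, t)‖ =
        ‖(Real.exp (-(q * t)) : ℂ) * G t‖ *
          ∫ z in Ioi (0 : ℝ), ‖dampedKernel μ β ε z‖ * yukawa a t z := by
      rw [← integral_const_mul]
      congr 1
      ext z
      rw [Function.uncurry_apply_pair, norm_mul, norm_mul _ (yukawa a t z : ℂ), Complex.norm_real,
        Real.norm_of_nonneg (yukawa_nonneg _ _ _)]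
      ring
    rw [this, Real.norm_of_nonneg (mul_nonneg (norm_nonneg _) (integral_nonneg fun z =>
      mul_nonneg (norm_nonneg _) (yukawa_nonneg _ _ _)))]
    exact hmaj t _ C ht hC (hbd t ht).1 (hbd t ht).2

/-! ### The damped integral of the shifted integrand and its limit. -/

theorem sqrt_double_sq (a z : ℝ) :
    Real.sqrt ((2 * a) ^ 2 + 4 * z ^ 2) = 2 * Real.sqrt (a ^ 2 + z ^ 2) := by
  rw [show (2 * a) ^ 2 + 4 * z ^ 2 = 2 ^ 2 * (a ^ 2 + z ^ 2) by ring,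
    Real.sqrt_mul (by norm_num), Real.sqrt_sq (by norm_num)]

theorem lt_sqrt_add_sq (ha : 0 < a) {z : ℝ} (hz : 0 < z) : a < Real.sqrt (a ^ 2 + z ^ 2) :=
  Real.lt_sqrt_of_sq_lt (by nlinarith [pow_pos hz 2])

/-- With `s = √(a²+z²)`, the argument of `F` is `s + q > q + a`, and `exp(-ts)/s` is the
subordinated factor. The `1/2` comes from `√((2a)²+4z²) = 2s`. -/
theorem shiftedIntegrand_mul_gaussian (ha : 0 < a)
    (hFG : IsInverseLaplace G F (q + a)) {ε z : ℝ} (hz : 0 < z) :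
    shiftedIntegrand μ β (2 * a) (q - a) F z * (Real.exp (-(ε * z ^ 2)) : ℂ) =
      1 / 2 * ∫ t in Ioi (0 : ℝ), dampedKernel μ β ε z * (yukawa a t z : ℂ) *
        ((Real.exp (-(q * t)) : ℂ) * G t) := by
  have hs := lt_sqrt_add_sq ha hz
  set s := Real.sqrt (a ^ 2 + z ^ 2) with hsdef
  have hx : (2 * s + 2 * a + 2 * (q - a)) / 2 = s + q := by ring
  have hI : ∫ t in Ioi (0 : ℝ), dampedKernel μ β ε z * (yukawa a t z : ℂ) *
      ((Real.exp (-(q * t)) : ℂ) * G t) = dampedKernel μ β ε z / (s : ℂ) * F (s + q) := by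
    rw [(hFG (s + q) (by linarith)).2, ← integral_const_mul]
    congr 1
    ext t
    rw [yukawa, ← hsdef, show (s + q) * t = t * s + q * t by ring, neg_add, Real.exp_add]
    push_cast
    ring
  rw [hI, shiftedIntegrand, sqrt_double_sq, ← hsdef, hx, dampedKernel, hankelKernel]
  push_cast
  ring

theorem integrableOn_shiftedIntegrand_mul_gaussian (hμ : -1 < μ.re) (hβ : 0 < β) (ha : 0 < a)
    (hFG : IsInverseLaplace G F (q + a))
    (hG : IntegrableOn (macdonaldIntegrand μ β q (2 * a) G) (Ioi 0)) {ε : ℝ} (hε : 0 < ε) :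
    IntegrableOn (fun z => shiftedIntegrand μ β (2 * a) (q - a) F z *
      (Real.exp (-(ε * z ^ 2)) : ℂ)) (Ioi 0) := by
  have h := (integrable_dampedKernel_mul_yukawa_prod hμ hβ ha hFG hG hε).integral_prod_left
  refine (h.const_mul (1 / 2)).congr ?_
  filter_upwards [ae_restrict_mem measurableSet_Ioi] with z hz
  exact (shiftedIntegrand_mul_gaussian ha hFG hz).symm

theorem integral_shiftedIntegrand_mul_gaussian (hμ : -1 < μ.re) (hβ : 0 < β) (ha : 0 < a)
    (hFG : IsInverseLaplace G F (q + a))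
    (hG : IntegrableOn (macdonaldIntegrand μ β q (2 * a) G) (Ioi 0)) {ε : ℝ} (hε : 0 < ε) :
    ∫ z in Ioi (0 : ℝ), shiftedIntegrand μ β (2 * a) (q - a) F z *
      (Real.exp (-(ε * z ^ 2)) : ℂ) =
      1 / 2 * ∫ t in Ioi (0 : ℝ), (Real.exp (-(q * t)) : ℂ) * G t *
        ∫ z in Ioi (0 : ℝ), dampedKernel μ β ε z * (yukawa a t z : ℂ) := by
  have h := integral_integral_swap (integrable_dampedKernel_mul_yukawa_prod hμ hβ ha hFG hG hε)
  rw [setIntegral_congr_fun measurableSet_Ioi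
    (fun z hz => shiftedIntegrand_mul_gaussian ha hFG hz), integral_const_mul, h]
  congr 2
  ext t
  rw [integral_mul_const, mul_comm]

theorem integral_transform_constant (hβ : 0 < β) (ha : 0 < a) :
    1 / 2 * (1 / (2 * Real.sqrt Real.pi : ℂ) * (1 / 2 * ((β / 2 : ℝ) : ℂ) ^ μ *
      (4 : ℂ) ^ (μ + 1))) = (β : ℂ) ^ μ * ((2 * a : ℝ) : ℂ) ^ (μ + 1 / 2) /
        ((2 : ℂ) ^ (μ + 1) * (Real.sqrt Real.pi : ℂ)) *
        (2 * ((a / 2 : ℝ) : ℂ) ^ (μ + 1 / 2))⁻¹ := by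
  have hpi : (Real.sqrt Real.pi : ℂ) ≠ 0 := by
    exact_mod_cast (Real.sqrt_pos.2 Real.pi_pos).ne'
  have h2 : (2 : ℂ) ^ μ ≠ 0 := by simp [Complex.cpow_eq_zero_iff]
  have hA : ((a / 2 : ℝ) : ℂ) ^ (μ + 1 / 2) ≠ 0 := by
    rw [Complex.cpow_ne_zero_iff]
    left
    exact_mod_cast (by positivity : a / 2 ≠ 0)
  have h4 : (4 : ℂ) ^ μ = (2 : ℂ) ^ μ * (2 : ℂ) ^ μ := by
    have := Complex.mul_cpow_ofReal_nonneg (a := 2) (b := 2) (by norm_num) (by norm_num) μ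
    push_cast at this
    rw [← this]; norm_num
  have hhalf : (4 : ℂ) ^ (1 / 2 : ℂ) = 2 := by
    rw [show (4 : ℂ) = ((2 : ℂ)) ^ 2 by norm_num, one_div]
    exact Complex.sq_cpow_two_inv (by norm_num)
  have e1 : (β : ℂ) ^ μ = ((β / 2 : ℝ) : ℂ) ^ μ * (2 : ℂ) ^ μ := by
    have := Complex.mul_cpow_ofReal_nonneg (a := β / 2) (b := 2) (by positivity) (by norm_num) μ
    rw [← Complex.ofReal_mul, div_mul_cancel₀ _ two_ne_zero] at this
    rw [this]; norm_num
  have e2 : ((2 * a : ℝ) : ℂ) ^ (μ + 1 / 2) =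
      2 * ((2 : ℂ) ^ μ * (2 : ℂ) ^ μ) * ((a / 2 : ℝ) : ℂ) ^ (μ + 1 / 2) := by
    have := Complex.mul_cpow_ofReal_nonneg (a := 4) (b := a / 2) (by norm_num) (by positivity)
      (μ + 1 / 2)
    rw [← Complex.ofReal_mul, show 4 * (a / 2) = 2 * a by ring] at this
    rw [this, ← h4]
    push_cast
    rw [Complex.cpow_add _ _ (by norm_num), hhalf]
    ring
  rw [e1, e2, Complex.cpow_add _ _ (by norm_num : (4 : ℂ) ≠ 0), Complex.cpow_one, h4,
    Complex.cpow_add _ _ (by norm_num : (2 : ℂ) ≠ 0), Complex.cpow_one]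
  generalize ((a / 2 : ℝ) : ℂ) ^ (μ + 1 / 2) = A at hA
  generalize ((β / 2 : ℝ) : ℂ) ^ μ = B
  field_simp
  ring

theorem tendsto_integral_shiftedIntegrand_mul_gaussian (hμ : -1 < μ.re) (hβ : 0 < β) (ha : 0 < a)
    (hFG : IsInverseLaplace G F (q + a))
    (hG : IntegrableOn (macdonaldIntegrand μ β q (2 * a) G) (Ioi 0)) :
    Tendsto (fun ε : ℝ => ∫ z in Ioi (0 : ℝ), shiftedIntegrand μ β (2 * a) (q - a) F z *
      (Real.exp (-(ε * z ^ 2)) : ℂ)) (𝓝[>] 0)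
      (𝓝 ((β : ℂ) ^ μ * ((2 * a : ℝ) : ℂ) ^ (μ + 1 / 2) /
        ((2 : ℂ) ^ (μ + 1) * (Real.sqrt Real.pi : ℂ)) *
          ∫ t in Ioi (0 : ℝ), macdonaldIntegrand μ β q (2 * a) G t)) := by
  obtain ⟨b, hb, hmaj⟩ := exists_majorant hμ hβ ha hFG hG
  obtain ⟨C, hC, hbd⟩ := exists_norm_dampedTransform_le hμ hβ ha
  set D : ℂ := 1 / (2 * Real.sqrt Real.pi : ℂ) * (1 / 2 * ((β / 2 : ℝ) : ℂ) ^ μ *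
    (4 : ℂ) ^ (μ + 1)) with hD
  have hlim : Tendsto (fun ε : ℝ => ∫ t in Ioi (0 : ℝ), (Real.exp (-(q * t)) : ℂ) * G t *
        ∫ z in Ioi (0 : ℝ), dampedKernel μ β ε z * (yukawa a t z : ℂ)) (𝓝[>] 0)
      (𝓝 (∫ t in Ioi (0 : ℝ), (Real.exp (-(q * t)) : ℂ) * G t * (D *
        ∫ r in Ioi (0 : ℝ), macWeight (μ + 1 / 2) (Real.sqrt (t ^ 2 + β ^ 2)) a r))) := by
    refine tendsto_integral_filter_of_dominated_convergence (fun t => C * b t) ?_ ?_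
      (hb.const_mul C) ?_
    · filter_upwards [self_mem_nhdsWithin] with ε hε
      refine (integrable_dampedKernel_mul_yukawa_prod hμ hβ ha hFG hG
        hε).integral_prod_right.aestronglyMeasurable.congr (Eventually.of_forall fun t => ?_)
      change ∫ z in Ioi (0 : ℝ), dampedKernel μ β ε z * (yukawa a t z : ℂ) *
        ((Real.exp (-(q * t)) : ℂ) * G t) = _
      rw [integral_mul_const, mul_comm]
    · filter_upwards [self_mem_nhdsWithin] with ε hε
      filter_upwards [ae_restrict_mem measurableSet_Ioi] with t ht
      rw [norm_mul]
      exact hmaj t _ C ht hC (hbd ε t hε ht).1 (hbd ε t hε ht).2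
    · filter_upwards [ae_restrict_mem measurableSet_Ioi] with t ht
      refine Tendsto.const_mul _ ?_
      have := tendsto_dampedTransform hμ hβ ha ht
      rwa [← mul_assoc] at this
  have hval : (β : ℂ) ^ μ * ((2 * a : ℝ) : ℂ) ^ (μ + 1 / 2) /
        ((2 : ℂ) ^ (μ + 1) * (Real.sqrt Real.pi : ℂ)) *
          ∫ t in Ioi (0 : ℝ), macdonaldIntegrand μ β q (2 * a) G t =
      1 / 2 * ∫ t in Ioi (0 : ℝ), (Real.exp (-(q * t)) : ℂ) * G t * (D *
        ∫ r in Ioi (0 : ℝ), macWeight (μ + 1 / 2) (Real.sqrt (t ^ 2 + β ^ 2)) a r) := by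
    have hcon := integral_transform_constant (μ := μ) hβ ha
    simp only [macdonaldIntegrand_eq hβ ha, mul_left_comm _ D]
    rw [integral_const_mul, integral_const_mul, ← mul_assoc, ← mul_assoc, ← hcon]
  rw [hval]
  refine (hlim.const_mul _).congr' ?_
  filter_upwards [self_mem_nhdsWithin] with ε hε
  exact (integral_shiftedIntegrand_mul_gaussian hμ hβ ha hFG hG hε).symm

theorem eq_of_hasImproperIntegral_shiftedIntegrand (hμ : -1 < μ.re) (hβ : 0 < β) (ha : 0 < a)
    (hFG : IsInverseLaplace G F (q + a))
    (hG : IntegrableOn (macdonaldIntegrand μ β q (2 * a) G) (Ioi 0)) {L : ℂ}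
    (hL : HasImproperIntegral (shiftedIntegrand μ β (2 * a) (q - a) F) 0 L) :
    L = (β : ℂ) ^ μ * ((2 * a : ℝ) : ℂ) ^ (μ + 1 / 2) /
        ((2 : ℂ) ^ (μ + 1) * (Real.sqrt Real.pi : ℂ)) *
          ∫ t in Ioi (0 : ℝ), macdonaldIntegrand μ β q (2 * a) G t :=
  tendsto_nhds_unique (HasImproperIntegral.tendsto_gaussian hL fun _ hε =>
    integrableOn_shiftedIntegrand_mul_gaussian hμ hβ ha hFG hG hε)
    (tendsto_integral_shiftedIntegrand_mul_gaussian hμ hβ ha hFG hG)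

end

/-! ### The change of variable -/

section
variable {μ : ℂ} {β q a : ℝ} {F : ℝ → ℂ}

/-- The substitution `x = √(a²+z²) + q`, with `z² = (x-q-a)(x-q+a)`. -/
noncomputable def substMap (a q z : ℝ) : ℝ := Real.sqrt (a ^ 2 + z ^ 2) + q

theorem substMap_lt_substMap {z w : ℝ} (hz : 0 ≤ z) (hzw : z < w) :
    substMap a q z < substMap a q w := by
  unfold substMap
  have : Real.sqrt (a ^ 2 + z ^ 2) < Real.sqrt (a ^ 2 + w ^ 2) :=
    Real.sqrt_lt_sqrt (by positivity) (by gcongr)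
  linarith

theorem substMap_zero (ha : 0 < a) : substMap a q 0 = q + a := by
  rw [substMap, zero_pow two_ne_zero, add_zero, Real.sqrt_sq ha.le, add_comm]

theorem substMap_sqrt {x : ℝ} (ha : 0 < a) (hx : q + a < x) :
    substMap a q (Real.sqrt ((x - q) ^ 2 - a ^ 2)) = x := by
  have h1 : 0 ≤ (x - q) ^ 2 - a ^ 2 := by nlinarith
  rw [substMap, Real.sq_sqrt h1, add_sub_cancel, Real.sqrt_sq (by linarith), sub_add_cancel]

theorem sqrt_sub_sq_pos {x : ℝ} (ha : 0 < a) (hx : q + a < x) :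
    0 < Real.sqrt ((x - q) ^ 2 - a ^ 2) := Real.sqrt_pos.2 (by nlinarith)

theorem image_substMap_Ioo (ha : 0 < a) {S : ℝ} (hS : 0 ≤ S) :
    substMap a q '' Ioo 0 S = Ioo (q + a) (substMap a q S) := by
  ext x
  constructor
  · rintro ⟨z, ⟨hz, hzS⟩, rfl⟩
    refine ⟨?_, substMap_lt_substMap hz.le hzS⟩
    rw [← substMap_zero (q := q) ha]
    exact substMap_lt_substMap le_rfl hz
  · rintro ⟨h1, h2⟩
    refine ⟨Real.sqrt ((x - q) ^ 2 - a ^ 2), ⟨sqrt_sub_sq_pos ha h1, ?_⟩, substMap_sqrt ha h1⟩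
    by_contra! hle
    have hx := substMap_sqrt ha h1
    rcases hle.eq_or_lt with h | h
    · rw [← h] at hx
      exact h2.ne' hx
    · have := substMap_lt_substMap (a := a) (q := q) hS h
      rw [hx] at this
      exact absurd h2 this.not_gt

theorem hasDerivAt_substMap (ha : 0 < a) (z : ℝ) :
    HasDerivAt (substMap a q) (z / Real.sqrt (a ^ 2 + z ^ 2)) z := by
  have h0 : a ^ 2 + z ^ 2 ≠ 0 := by positivity
  have h := ((((hasDerivAt_id z).pow 2).const_add (a ^ 2)).sqrt h0).add_const q
  convert! h using 1
  simp
  field_simp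

theorem injOn_substMap (S : ℝ) : InjOn (substMap a q) (Ioo 0 S) := by
  have : StrictMonoOn (substMap a q) (Ioo 0 S) :=
    fun z hz w _ h => substMap_lt_substMap hz.1.le h
  exact this.injOn

/-- The two power factors combine to `(z²)^(μ/2) = z^μ`, the Jacobian `z/s` supplies the missing
power of `z`, and the 2 comes from the denominator `2s` of the shifted integrand. -/
theorem twoPointIntegrand_substMap (ha : 0 < a) {z : ℝ} (hz : 0 < z) :
    |z / Real.sqrt (a ^ 2 + z ^ 2)| • twoPointIntegrand μ β (q + a) (q - a) F (substMap a q z) =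
      2 * shiftedIntegrand μ β (2 * a) (q - a) F z := by
  have hs := lt_sqrt_add_sq ha hz
  have hsq : Real.sqrt (a ^ 2 + z ^ 2) ^ 2 = a ^ 2 + z ^ 2 := Real.sq_sqrt (by positivity)
  rw [twoPointIntegrand, shiftedIntegrand, sqrt_double_sq, substMap]
  set s := Real.sqrt (a ^ 2 + z ^ 2)
  have hs0 : 0 < s := ha.trans hs
  have e1 : s + q - (q + a) = s - a := by ring
  have e2 : s + q - (q - a) = s + a := by ring
  have e3 : (s - a) * (s + a) = z ^ 2 := by linear_combination hsq
  have e4 : (2 * s + 2 * a + 2 * (q - a)) / 2 = s + q := by ring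
  have e5 : ((z ^ 2 : ℝ) : ℂ) ^ (μ / 2) = (z : ℂ) ^ μ := by
    rw [← Real.rpow_two, ← Complex.cpow_mul_ofReal_nonneg hz.le]
    congr 1; push_cast; ring
  have hz' : (z : ℂ) ≠ 0 := by exact_mod_cast hz.ne'
  have hs' : (s : ℂ) ≠ 0 := by exact_mod_cast hs0.ne'
  rw [e1, e2, e3, e4, Real.sqrt_sq hz.le,
    ← Complex.mul_cpow_ofReal_nonneg (by linarith) (by linarith), ← Complex.ofReal_mul, e3, e5,
    abs_of_pos (by positivity), Complex.real_smul, Complex.cpow_add _ _ hz', Complex.cpow_one]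
  push_cast
  field_simp

theorem intervalIntegrable_twoPointIntegrand_iff (ha : 0 < a) {S : ℝ} (hS : 0 < S) :
    IntervalIntegrable (twoPointIntegrand μ β (q + a) (q - a) F) volume (q + a) (substMap a q S) ↔
      IntervalIntegrable (shiftedIntegrand μ β (2 * a) (q - a) F) volume 0 S := by
  have hle : q + a ≤ substMap a q S := by
    rw [← substMap_zero (q := q) ha]; exact (substMap_lt_substMap le_rfl hS).le
  rw [intervalIntegrable_iff_integrableOn_Ioo_of_le hle,
    intervalIntegrable_iff_integrableOn_Ioo_of_le hS.le, ← image_substMap_Ioo ha hS.le,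
    integrableOn_image_iff_integrableOn_abs_deriv_smul measurableSet_Ioo
      (fun z _ => (hasDerivAt_substMap ha z).hasDerivWithinAt) (injOn_substMap S),
    integrableOn_congr_fun (fun z hz => twoPointIntegrand_substMap ha hz.1) measurableSet_Ioo]
  exact integrable_const_mul_iff (Ne.isUnit two_ne_zero) _

theorem integral_twoPointIntegrand (ha : 0 < a) {S : ℝ} (hS : 0 < S) :
    ∫ x in (q + a)..substMap a q S, twoPointIntegrand μ β (q + a) (q - a) F x =
      2 * ∫ z in (0 : ℝ)..S, shiftedIntegrand μ β (2 * a) (q - a) F z := by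
  have hle : q + a ≤ substMap a q S := by
    rw [← substMap_zero (q := q) ha]; exact (substMap_lt_substMap le_rfl hS).le
  rw [intervalIntegral.integral_of_le hle, intervalIntegral.integral_of_le hS.le,
    integral_Ioc_eq_integral_Ioo, integral_Ioc_eq_integral_Ioo, ← image_substMap_Ioo ha hS.le,
    integral_image_eq_integral_abs_deriv_smul measurableSet_Ioo
      (fun z _ => (hasDerivAt_substMap ha z).hasDerivWithinAt) (injOn_substMap S),
    setIntegral_congr_fun measurableSet_Ioo (fun z hz => twoPointIntegrand_substMap ha hz.1),
    integral_const_mul]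

theorem hasImproperIntegral_twoPointIntegrand_iff (ha : 0 < a) (L : ℂ) :
    HasImproperIntegral (twoPointIntegrand μ β (q + a) (q - a) F) (q + a) L ↔
      HasImproperIntegral (shiftedIntegrand μ β (2 * a) (q - a) F) 0 (L / 2) := by
  have hsub : Tendsto (substMap a q) atTop atTop := by
    refine tendsto_atTop_mono (fun z => ?_) (tendsto_atTop_add_const_right _ q tendsto_id)
    have : z ≤ Real.sqrt (a ^ 2 + z ^ 2) := Real.le_sqrt_of_sq_le (by nlinarith [sq_nonneg a])
    simp only [substMap, id]
    linarith
  have hinv : Tendsto (fun x : ℝ => Real.sqrt ((x - q) ^ 2 - a ^ 2)) atTop atTop := by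
    refine tendsto_atTop_mono' _ ?_ (tendsto_atTop_add_const_right _ (-q - a) tendsto_id)
    filter_upwards [eventually_gt_atTop (q + a)] with x hx
    apply Real.le_sqrt_of_sq_le
    simp only [id]
    nlinarith
  constructor
  · rintro ⟨h1, h2⟩
    refine ⟨fun S hS => (intervalIntegrable_twoPointIntegrand_iff ha hS).1 (h1 _ ?_), ?_⟩
    · rw [← substMap_zero (q := q) ha]; exact substMap_lt_substMap le_rfl hS
    · refine ((h2.comp hsub).div_const 2).congr' ?_
      filter_upwards [eventually_gt_atTop 0] with S hS
      simp only [Function.comp]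
      rw [integral_twoPointIntegrand ha hS]
      ring
  · rintro ⟨h1, h2⟩
    -- Every `R > q + a` is the image of `√((R-q)² - a²)`, which tends to infinity with `R`.
    refine ⟨fun R hR => ?_, ?_⟩
    · have := (intervalIntegrable_twoPointIntegrand_iff (μ := μ) (β := β) (F := F) ha
        (sqrt_sub_sq_pos ha hR)).2 (h1 _ (sqrt_sub_sq_pos ha hR))
      rwa [substMap_sqrt ha hR] at this
    · have := (h2.comp hinv).const_mul 2
      rw [mul_div_cancel₀ _ two_ne_zero] at this
      refine this.congr' ?_
      filter_upwards [eventually_gt_atTop (q + a)] with R hR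
      simp only [Function.comp]
      rw [← integral_twoPointIntegrand ha (sqrt_sub_sq_pos ha hR), substMap_sqrt ha hR]

end
end TwoPoint

theorem mainTheorem5 (μ : ℂ) (hμ : -1 < μ.re) (β p p₁ : ℝ) (hβ : 0 < β) (hp : p₁ < p)
    (F G : ℝ → ℂ) (hFG : IsInverseLaplace G F p)
    (hG : MeasureTheory.IntegrableOn (macdonaldIntegrand μ β ((p + p₁) / 2) (p - p₁) G)
      (Set.Ioi 0)) :
    -- the two-point formula, whenever its left-hand side converges
    ((∃ L : ℂ, HasImproperIntegral (twoPointIntegrand μ β p p₁ F) p L) →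
      HasImproperIntegral (twoPointIntegrand μ β p p₁ F) p
        ((β : ℂ) ^ μ * ((p - p₁ : ℝ) : ℂ) ^ (μ + 1 / 2) / ((2 : ℂ) ^ μ * (Real.sqrt Real.pi : ℂ)) *
          ∫ t in Set.Ioi (0 : ℝ), macdonaldIntegrand μ β ((p + p₁) / 2) (p - p₁) G t)) ∧
    ∀ α : ℝ, α = p - p₁ →
      -- the form after the change of variable `s = √((x-p)(x-p₁))`
      ((∃ L : ℂ, HasImproperIntegral (shiftedIntegrand μ β α p₁ F) 0 L) →
        HasImproperIntegral (shiftedIntegrand μ β α p₁ F) 0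
          ((β : ℂ) ^ μ * (α : ℂ) ^ (μ + 1 / 2) / ((2 : ℂ) ^ (μ + 1) * (Real.sqrt Real.pi : ℂ)) *
            ∫ t in Set.Ioi (0 : ℝ), macdonaldIntegrand μ β (p₁ + α / 2) α G t)) ∧
      -- the two left-hand sides converge together, the second to half the value of the first
      ∀ L : ℂ, HasImproperIntegral (twoPointIntegrand μ β p p₁ F) p L ↔
        HasImproperIntegral (shiftedIntegrand μ β α p₁ F) 0 (L / 2) := by
  have ha : 0 < (p - p₁) / 2 := by linarith
  -- Half-distance and midpoint place the two points symmetrically at `q ± a`.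
  set a := (p - p₁) / 2 with hadef
  set q := (p + p₁) / 2 with hqdef
  have e1 : p = q + a := by rw [hadef, hqdef]; ring
  have e2 : p₁ = q - a := by rw [hadef, hqdef]; ring
  have e3 : p - p₁ = 2 * a := by rw [hadef]; ring
  have e4 : p₁ + 2 * a / 2 = q := by rw [e2]; ring
  have hFG' : IsInverseLaplace G F (q + a) := e1 ▸ hFG
  rw [e3] at hG
  have hiff : ∀ L : ℂ, HasImproperIntegral (twoPointIntegrand μ β p p₁ F) p L ↔
      HasImproperIntegral (shiftedIntegrand μ β (2 * a) p₁ F) 0 (L / 2) := by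
    rw [e1, e2]
    exact TwoPoint.hasImproperIntegral_twoPointIntegrand_iff ha
  have hval : ∀ L : ℂ, HasImproperIntegral (shiftedIntegrand μ β (2 * a) p₁ F) 0 L →
      L = (β : ℂ) ^ μ * ((2 * a : ℝ) : ℂ) ^ (μ + 1 / 2) /
        ((2 : ℂ) ^ (μ + 1) * (Real.sqrt Real.pi : ℂ)) *
          ∫ t in Set.Ioi (0 : ℝ), macdonaldIntegrand μ β q (2 * a) G t := by
    rw [e2]
    exact fun L hL => TwoPoint.eq_of_hasImproperIntegral_shiftedIntegrand hμ hβ ha hFG' hG hL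
  refine ⟨?_, ?_⟩
  · rintro ⟨L, hL⟩
    have h := hval _ ((hiff L).1 hL)
    have h2 : (2 : ℂ) ^ (μ + 1) = 2 ^ μ * 2 := by
      rw [Complex.cpow_add _ _ two_ne_zero, Complex.cpow_one]
    rw [h2] at h
    have hL2 : L = 2 * (L / 2) := by ring
    rw [h] at hL2
    rw [e3]
    -- The integral already converges to `L`, so only the value of `L` remains to be identified; the
    -- factor 2 from the substitution turns `2^(μ+1)` into `2^μ`.
    convert hL using 1
    rw [hL2]
    have hpi : (Real.sqrt Real.pi : ℂ) ≠ 0 := by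
      exact_mod_cast (Real.sqrt_pos.2 Real.pi_pos).ne'
    have h2μ : (2 : ℂ) ^ μ ≠ 0 := by simp [Complex.cpow_eq_zero_iff]
    field_simp
  · rintro α hα
    rw [e3] at hα
    subst hα
    rw [e4]
    refine ⟨?_, hiff⟩
    rintro ⟨L, hL⟩
    rwa [← hval L hL]
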